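/- For an integer $L\ge 0$, let the sparsified $L\times L$ square grid $S_L$ be the graph obtained from the $L\times L$ square grid graph by replacing every edge by a path with $L$ edges (and $L-1$ new inner vertices); it has $v(L)=2L(L-1)^2+L^2$ vertices. Let $1/2<c<1$ and $k=\min\left\{\frac{1-c}{2},\frac{c}{3}\right\}$. Let $d=d(n)$ be a sequence of non-negative integers with $d(n)=\Theta(n^c)$ (in particular, $d=n^c$ up to rounding), and let $L=L(n)$ be any sequence of non-negative integers such that $v(L(n))=o(n^k)$. Let $G$ be a uniformly random $d(n)$-regular simple graph on $n$ vertices. Then, as $n\to\infty$ through those $n$ for which $n\,d(n)$ is even, $$\Pr\left[\,G\text{ contains }S_{L(n)}\text{ as an induced subgraph}\,\right]\longrightarrow 1 .$$ -/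

import Mathlib

open Filter Asymptotics Topology MeasureTheory ProbabilityTheory

/-- The law of a uniformly random `d`-regular simple graph on the vertex set `{0, …, n - 1}`:
the uniform distribution on the finite set of all such graphs. -/
noncomputable def randomRegularGraph (n d : ℕ) : Measure (SimpleGraph (Fin n)) :=
  open Classical in uniformOn {G | G.IsRegularOfDegree d}

/-- The `L × L` square grid graph. -/
def squareGrid (L : ℕ) : SimpleGraph (Fin L × Fin L) :=
  (SimpleGraph.pathGraph L).boxProd (SimpleGraph.pathGraph L)

/-- The edges of the `L × L` grid. Each edge is recorded once, as the pair of its endpoints in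
increasing order for the coordinatewise order. -/
def GridEdge (L : ℕ) : Type :=
  {p : (Fin L × Fin L) × (Fin L × Fin L) // (squareGrid L).Adj p.1 p.2 ∧ p.1 ≤ p.2}

/-- The two endpoints of a grid edge are comparable for the coordinatewise order, so that
`GridEdge` lists every edge of the grid. -/
theorem squareGrid_adj_comparable {L : ℕ} {x y : Fin L × Fin L} (h : (squareGrid L).Adj x y) :
    x ≤ y ∨ y ≤ x := by
  rw [squareGrid, SimpleGraph.boxProd_adj, SimpleGraph.pathGraph_adj,
    SimpleGraph.pathGraph_adj] at h
  simp only [Prod.le_def, Fin.le_def]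
  omega

/-- The vertices of the sparsified `L × L` grid: the grid vertices, and `L - 1` new vertices for
every edge of the grid. -/
abbrev SparsifiedGridVertex (L : ℕ) : Type :=
  (Fin L × Fin L) ⊕ (GridEdge L × Fin (L - 1))

/-- The `i`-th vertex, `0 ≤ i ≤ L`, of the line with `L` edges that replaces the grid edge `e`:
the first endpoint of `e` for `i = 0`, the new vertices for `0 < i < L`, and the second endpoint
of `e` for `i = L`. -/
def linePoint {L : ℕ} (e : GridEdge L) (i : ℕ) : SparsifiedGridVertex L :=
  if i = 0 then Sum.inl e.1.1
  else if h : i - 1 < L - 1 then Sum.inr (e, ⟨i - 1, h⟩)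
  else Sum.inl e.1.2

/-- The sparsified `L × L` square grid graph: every edge of the `L × L` grid is replaced by a path
with `L` edges and `L - 1` new inner vertices. -/
def sparsifiedGrid (L : ℕ) : SimpleGraph (SparsifiedGridVertex L) :=
  SimpleGraph.fromEdgeSet
    {s | ∃ (e : GridEdge L) (i : ℕ), i < L ∧ s = s(linePoint e i, linePoint e (i + 1))}

/-! Two facts combine. With high probability all codegrees of `G` are at most `K = (3/2) d²/n`, and
every `d`-regular graph with this property contains the sparsified grid, by a greedy embedding.

Greedy part. While a set `S` with `|S| (1 + K)` small against `d` is occupied, each vertex keeps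
nearly `d` private neighbours, since it shares at most `K` neighbours with any other vertex
(`le_card_privateNbrs`). This handles pendant vertices. Closing a cycle requires an induced path
with three inner vertices between prescribed vertices `u`, `v` (`exists_ear`). The private
neighbourhoods `A` of `u` and `C` of `v` each send about `d²` edges into the free vertices. If every
path `a b c` had `a` adjacent to `c`, there would be at most `d K²` such paths, so the two edge
distributions would be almost orthogonal. Cauchy–Schwarz and the codegree bound on second moments
then give roughly `4 d⁴ ≤ 2 n d² K = 3 d⁴`, which is absurd. Any constant below `2` in `K` would
leave room for this argument.

Grid part. For `L ≥ 4` each line has at least three inner vertices, so it is built from pendant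
vertices and one ear (`buildable_sparsifiedGrid`). For `L = 2, 3` ears run around corners of the
grid, and the graph is treated as a finite piece of the square lattice.

Random part. Switchings show that a prescribed edge set `F` with few edges lies in `G` with
probability at most `(1.1 d/n)^|F|` (`card_regularGraphs_le`). A binomial moment of order about
`d²/(10 n)` bounds the codegree tail by `0.9` to that power (`card_large_codegree_le`). This beats
the `n²` pairs because `d²/n` grows like `n^(2c-1)`. -/

namespace SimpleGraph

/-! ### Induced embeddings and building moves -/

/-- `f` embeds the subgraph of `H` induced on `T` into `G` as an induced subgraph. -/
def InducedOn {W V : Type*} (H : SimpleGraph W) (G : SimpleGraph V) (T : Finset W) (f : W → V) :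
    Prop :=
  Set.InjOn f T ∧ ∀ x ∈ T, ∀ y ∈ T, H.Adj x y ↔ G.Adj (f x) (f y)

/-- The sets of vertices of `H` which can be exhausted by adding, one after the other, isolated
vertices, pendant vertices, and induced paths with three inner vertices between distinct old
vertices. -/
inductive Buildable {W : Type*} [DecidableEq W] (H : SimpleGraph W) : Finset W → Prop
  | empty : Buildable H ∅
  | isolated (T : Finset W) (x : W) : Buildable H T → x ∉ T → (∀ y ∈ T, ¬ H.Adj x y) →
      Buildable H (insert x T)
  | pendant (T : Finset W) (x u : W) : Buildable H T → x ∉ T → u ∈ T →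
      (∀ y ∈ T, H.Adj x y ↔ y = u) → Buildable H (insert x T)
  | ear (T : Finset W) (u v a b c : W) : Buildable H T → u ∈ T → v ∈ T → u ≠ v →
      a ∉ T → b ∉ T → c ∉ T → a ≠ c → H.Adj a b → H.Adj b c → ¬ H.Adj a c →
      (∀ y ∈ T, H.Adj a y ↔ y = u) → (∀ y ∈ T, ¬ H.Adj b y) → (∀ y ∈ T, H.Adj c y ↔ y = v) →
      Buildable H (insert b (insert c (insert a T)))

section Extension

variable {W V : Type*} [DecidableEq W] {H : SimpleGraph W} {G : SimpleGraph V}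

theorem InducedOn.insert {T : Finset W} {f : W → V} (h : InducedOn H G T f) {x : W} (hx : x ∉ T)
    {p : V} (hp : ∀ y ∈ T, p ≠ f y) (hadj : ∀ y ∈ T, H.Adj x y ↔ G.Adj p (f y)) :
    InducedOn H G (insert x T) (Function.update f x p) := by
  have hne : ∀ y ∈ T, y ≠ x := fun y hy e => hx (e ▸ hy)
  constructor
  · intro y hy z hz hyz
    simp only [Finset.coe_insert, Set.mem_insert_iff, Finset.mem_coe] at hy hz
    rcases hy with rfl | hy <;> rcases hz with rfl | hz
    · rfl
    · rw [Function.update_self, Function.update_of_ne (hne z hz)] at hyz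
      exact absurd hyz (hp z hz)
    · rw [Function.update_self, Function.update_of_ne (hne y hy)] at hyz
      exact absurd hyz.symm (hp y hy)
    · rw [Function.update_of_ne (hne z hz), Function.update_of_ne (hne y hy)] at hyz
      exact h.1 hy hz hyz
  · intro y hy z hz
    rw [Finset.mem_insert] at hy hz
    rcases hy with rfl | hy <;> rcases hz with rfl | hz
    · simp
    · rw [Function.update_self, Function.update_of_ne (hne z hz)]
      exact hadj z hz
    · rw [Function.update_self, Function.update_of_ne (hne y hy), H.adj_comm, G.adj_comm]
      exact hadj y hy
    · rw [Function.update_of_ne (hne z hz), Function.update_of_ne (hne y hy)]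
      exact h.2 y hy z hz

end Extension

/-! ### Greedy embedding into regular graphs of small codegree -/

section Greedy

variable {V : Type*} [Fintype V] [DecidableEq V] {G : SimpleGraph V} [DecidableRel G.Adj]
  {d : ℕ} {K : ℝ}

/-- The neighbours of `w` which are neither in `S` nor adjacent to another vertex of `S`. -/
def privateNbrs (G : SimpleGraph V) [DecidableRel G.Adj] (S : Finset V) (w : V) : Finset V :=
  G.neighborFinset w \ (S ∪ (S.erase w).biUnion fun v => G.neighborFinset v)

theorem mem_privateNbrs {S : Finset V} {w x : V} :
    x ∈ privateNbrs G S w ↔ G.Adj w x ∧ x ∉ S ∧ ∀ v ∈ S, v ≠ w → ¬ G.Adj v x := by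
  simp only [privateNbrs, Finset.mem_sdiff, mem_neighborFinset, Finset.mem_union,
    Finset.mem_biUnion, Finset.mem_erase, not_or, not_exists, not_and]
  grind

/-- A neighbour of `w` is lost either by lying in `S` or by being a common neighbour of `w` and
another vertex of `S`; the latter costs at most `K` per vertex. Here `w` itself may lie outside `S`.
-/
theorem le_card_privateNbrs (hreg : ∀ v, G.degree v = d)
    (hK : ∀ u v, u ≠ v → ((G.neighborFinset u ∩ G.neighborFinset v).card : ℝ) ≤ K)
    (hK0 : 0 ≤ K) (S : Finset V) (w : V) :
    (d : ℝ) - S.card - S.card * K ≤ (privateNbrs G S w).card := by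
  have h1 : G.neighborFinset w ⊆ privateNbrs G S w ∪
      (S ∪ (S.erase w).biUnion fun v => G.neighborFinset w ∩ G.neighborFinset v) := by
    intro x hx
    simp only [privateNbrs, Finset.mem_sdiff, Finset.mem_union, Finset.mem_biUnion,
      Finset.mem_inter]
    simp only [hx, true_and]
    tauto
  have h2 : (((S.erase w).biUnion fun v => G.neighborFinset w ∩ G.neighborFinset v).card : ℝ)
      ≤ S.card * K := by
    calc (((S.erase w).biUnion fun v => G.neighborFinset w ∩ G.neighborFinset v).card : ℝ)
        ≤ ∑ v ∈ S.erase w, ((G.neighborFinset w ∩ G.neighborFinset v).card : ℝ) := by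
          exact_mod_cast Finset.card_biUnion_le
      _ ≤ ∑ v ∈ S.erase w, K :=
          Finset.sum_le_sum fun v hv => hK w v (Finset.ne_of_mem_erase hv).symm
      _ = (S.erase w).card * K := by rw [Finset.sum_const, nsmul_eq_mul]
      _ ≤ S.card * K := by
          gcongr
          exact Finset.erase_subset _ _
  have h3 : (G.neighborFinset w).card ≤ (privateNbrs G S w).card + (S.card +
      ((S.erase w).biUnion fun v => G.neighborFinset w ∩ G.neighborFinset v).card) :=
    (Finset.card_le_card h1).trans ((Finset.card_union_le _ _).trans
      (Nat.add_le_add_left (Finset.card_union_le _ _) _))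
  rw [card_neighborFinset_eq_degree, hreg] at h3
  have h4 : (d : ℝ) ≤ (privateNbrs G S w).card + (S.card +
      ((S.erase w).biUnion fun v => G.neighborFinset w ∩ G.neighborFinset v).card) := by
    exact_mod_cast h3
  linarith

/-- The number of common neighbours, as a sum of products of adjacency indicators. -/
theorem sum_adj_mul_adj (u v : V) :
    ∑ b, (if G.Adj u b then (1 : ℝ) else 0) * (if G.Adj v b then 1 else 0) =
      (G.neighborFinset u ∩ G.neighborFinset v).card := by
  rw [Finset.card_eq_sum_ones, Nat.cast_sum, ← Finset.sum_subset (Finset.subset_univ _)]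
  · refine Finset.sum_congr rfl fun b hb => ?_
    simp only [Finset.mem_inter, mem_neighborFinset] at hb
    simp [hb.1, hb.2]
  · intro b _ hb
    simp only [Finset.mem_inter, mem_neighborFinset] at hb
    split_ifs <;> simp_all

theorem sum_adj_eq_card (A : Finset V) (u : V) :
    ∑ b ∈ A, (if G.Adj u b then (1 : ℝ) else 0) = (G.neighborFinset u ∩ A).card := by
  rw [Finset.sum_boole]
  congr 2
  ext b
  simp [and_comm]

/-- Expanding the square turns the sum over `b` into codegrees over `A × A`: `d` on the diagonal and
at most `K` off it. -/
theorem sum_sq_le (hreg : ∀ v, G.degree v = d)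
    (hK : ∀ u v, u ≠ v → ((G.neighborFinset u ∩ G.neighborFinset v).card : ℝ) ≤ K)
    (hK0 : 0 ≤ K) (A U : Finset V) (hA : A.card ≤ d) :
    ∑ b ∈ U, (∑ a ∈ A, if G.Adj a b then (1 : ℝ) else 0) ^ 2 ≤ (d : ℝ) ^ 2 + d ^ 2 * K := by
  have hA' : (A.card : ℝ) ≤ d := by exact_mod_cast hA
  calc ∑ b ∈ U, (∑ a ∈ A, if G.Adj a b then (1 : ℝ) else 0) ^ 2
      ≤ ∑ b, (∑ a ∈ A, if G.Adj a b then (1 : ℝ) else 0) ^ 2 :=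
        Finset.sum_le_sum_of_subset_of_nonneg (Finset.subset_univ _) fun _ _ _ => sq_nonneg _
    _ = ∑ a ∈ A, ∑ c ∈ A, ((G.neighborFinset a ∩ G.neighborFinset c).card : ℝ) := by
        simp_rw [sq, Finset.sum_mul_sum, ← sum_adj_mul_adj]
        rw [Finset.sum_comm]
        refine Finset.sum_congr rfl fun a _ => ?_
        rw [Finset.sum_comm]
    _ ≤ ∑ a ∈ A, ∑ c ∈ A, ((if a = c then (d : ℝ) else 0) + K) := by
        refine Finset.sum_le_sum fun a _ => Finset.sum_le_sum fun c _ => ?_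
        split_ifs with h
        · subst h
          rw [Finset.inter_self, card_neighborFinset_eq_degree, hreg]
          linarith
        · rw [zero_add]
          exact hK a c h
    _ ≤ ∑ a ∈ A, ((d : ℝ) + d * K) := by
        refine Finset.sum_le_sum fun a ha => ?_
        rw [Finset.sum_add_distrib, Finset.sum_ite_eq, if_pos ha, Finset.sum_const, nsmul_eq_mul]
        gcongr
    _ ≤ (d : ℝ) ^ 2 + d ^ 2 * K := by
        rw [Finset.sum_const, nsmul_eq_mul]
        nlinarith [mul_nonneg (Nat.cast_nonneg (α := ℝ) d) hK0, Nat.cast_nonneg (α := ℝ) d]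

/-- Without such a path, the degrees into `A` and into `C` are nearly orthogonal functions on `U`.
Their sum then has too small a second moment for its first moment. -/
theorem exists_ear (hreg : ∀ v, G.degree v = d) (hd : 0 < d)
    (hK : ∀ u v, u ≠ v → ((G.neighborFinset u ∩ G.neighborFinset v).card : ℝ) ≤ K)
    (hK0 : 0 ≤ K) (hKd : 100 * K ≤ d) (hnK : Fintype.card V * K ≤ 3 / 2 * (d : ℝ) ^ 2)
    (hn : 100 * (Fintype.card V : ℝ) ≤ (d : ℝ) ^ 2) {S : Finset V}
    (hS : 50 * (S.card + S.card * K) ≤ d) {u v : V} (hv : v ∈ S) (huv : u ≠ v) :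
    ∃ a b c, a ∈ privateNbrs G S u ∧ c ∈ privateNbrs G S v ∧ (b ∉ S ∧ ∀ w ∈ S, ¬ G.Adj w b) ∧
      G.Adj a b ∧ G.Adj c b ∧ ¬ G.Adj a c := by
  by_contra! hcon
  set M : V → V → ℝ := fun a b => if G.Adj a b then 1 else 0 with hM
  set A := privateNbrs G S u
  set C := privateNbrs G S v
  set U := Finset.univ.filter fun b => b ∉ S ∧ ∀ w ∈ S, ¬ G.Adj w b with hU
  set m : ℝ := 49 / 50 * d with hm
  have hm0 : 0 ≤ m := by positivity
  have hM0 : ∀ a b, 0 ≤ M a b := fun a b => by simp only [hM]; split_ifs <;> norm_num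
  have hpriv : ∀ w, m ≤ (privateNbrs G S w).card := fun w => by
    have := le_card_privateNbrs hreg hK hK0 S w
    linarith
  have hcard : ∀ w, (privateNbrs G S w).card ≤ d := fun w => by
    rw [← hreg w, ← card_neighborFinset_eq_degree]
    exact Finset.card_le_card Finset.sdiff_subset
  have hAC : ∀ a ∈ A, ∀ c ∈ C, a ≠ c := by
    rintro a ha _ hc rfl
    exact (mem_privateNbrs.1 ha).2.2 v hv huv.symm (mem_privateNbrs.1 hc).1
  have hsum : ∀ w, m ^ 2 ≤ ∑ b ∈ U, ∑ a ∈ privateNbrs G S w, M a b := fun w => by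
    rw [Finset.sum_comm]
    calc m ^ 2 ≤ ∑ a ∈ privateNbrs G S w, m := by
          rw [Finset.sum_const, nsmul_eq_mul, sq]
          exact mul_le_mul_of_nonneg_right (hpriv w) hm0
      _ ≤ _ := by
          refine Finset.sum_le_sum fun a ha => ?_
          rw [sum_adj_eq_card]
          -- Since `a` is outside `S`, a private neighbour of `a` is adjacent to no vertex of `S` at
          -- all, hence lies in `U`.
          refine (hpriv a).trans ?_
          have haS := (mem_privateNbrs.1 ha).2.1
          exact_mod_cast Finset.card_le_card fun b hb => by
            rw [mem_privateNbrs] at hb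
            simp only [Finset.mem_inter, mem_neighborFinset, hU, Finset.mem_filter,
              Finset.mem_univ, true_and]
            exact ⟨hb.1, hb.2.1, fun w hw => hb.2.2 w hw fun e => haS (e ▸ hw)⟩
  -- Each path `a b c` forces the edge `ac`. For fixed `a` there are at most `K` such `c`, because
  -- they are common neighbours of `a` and `v`; for each pair `a`, `c` there are at most `K` choices
  -- of `b`.
  have hprod : ∑ b ∈ U, (∑ a ∈ A, M a b) * (∑ c ∈ C, M c b) ≤ d * K ^ 2 := by
    calc ∑ b ∈ U, (∑ a ∈ A, M a b) * (∑ c ∈ C, M c b)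
        = ∑ b ∈ U, ∑ a ∈ A, ∑ c ∈ C, M a b * M c b := by simp_rw [Finset.sum_mul_sum]
      _ ≤ ∑ b ∈ U, ∑ a ∈ A, ∑ c ∈ C, M a c * (M a b * M c b) := by
          refine Finset.sum_le_sum fun b hb => Finset.sum_le_sum fun a ha =>
            Finset.sum_le_sum fun c hc => ?_
          have := hcon a b c ha hc (by simpa [hU] using hb)
          simp only [hM]
          split_ifs <;> simp_all
      _ = ∑ a ∈ A, ∑ c ∈ C, M a c * ∑ b ∈ U, M a b * M c b := by
          rw [Finset.sum_comm]
          refine Finset.sum_congr rfl fun a _ => ?_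
          rw [Finset.sum_comm]
          simp_rw [Finset.mul_sum]
      _ ≤ ∑ a ∈ A, ∑ c ∈ C, M a c * K := by
          refine Finset.sum_le_sum fun a ha => Finset.sum_le_sum fun c hc =>
            mul_le_mul_of_nonneg_left ?_ (hM0 a c)
          refine le_trans ?_ (hK a c (hAC a ha c hc))
          rw [← sum_adj_mul_adj]
          exact Finset.sum_le_sum_of_subset_of_nonneg (Finset.subset_univ _)
            fun b _ _ => mul_nonneg (hM0 a b) (hM0 c b)
      _ ≤ ∑ a ∈ A, K * K := by
          refine Finset.sum_le_sum fun a ha => ?_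
          rw [← Finset.sum_mul, sum_adj_eq_card]
          refine mul_le_mul_of_nonneg_right ?_ hK0
          refine le_trans ?_ (hK a v fun e => (mem_privateNbrs.1 ha).2.1 (e ▸ hv))
          exact_mod_cast Finset.card_le_card
            (Finset.inter_subset_inter_left Finset.sdiff_subset)
      _ ≤ d * K ^ 2 := by
          rw [Finset.sum_const, nsmul_eq_mul, ← sq]
          exact mul_le_mul_of_nonneg_right (by exact_mod_cast hcard u) (sq_nonneg K)
  have hA2 : ∑ b ∈ U, (∑ a ∈ A, M a b) ^ 2 ≤ (d : ℝ) ^ 2 + d ^ 2 * K :=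
    sum_sq_le hreg hK hK0 A U (hcard u)
  have hC2 : ∑ b ∈ U, (∑ a ∈ C, M a b) ^ 2 ≤ (d : ℝ) ^ 2 + d ^ 2 * K :=
    sum_sq_le hreg hK hK0 C U (hcard v)
  -- Cauchy–Schwarz is applied to the sum of the two degree functions, so that the cross term is the
  -- small quantity of `hprod`.
  have hcs := sq_sum_le_card_mul_sum_sq (s := U)
    (f := fun b => ∑ a ∈ A, M a b + ∑ c ∈ C, M c b)
  have hexp : ∑ b ∈ U, (∑ a ∈ A, M a b + ∑ c ∈ C, M c b) ^ 2 =
      ∑ b ∈ U, (∑ a ∈ A, M a b) ^ 2 + 2 * ∑ b ∈ U, (∑ a ∈ A, M a b) * (∑ c ∈ C, M c b) +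
        ∑ b ∈ U, (∑ c ∈ C, M c b) ^ 2 := by
    rw [Finset.mul_sum, ← Finset.sum_add_distrib, ← Finset.sum_add_distrib]
    exact Finset.sum_congr rfl fun b _ => by ring
  have hUn : (U.card : ℝ) ≤ Fintype.card V := by exact_mod_cast Finset.card_le_univ U
  have hlow : (2 * m ^ 2) ^ 2 ≤ (∑ b ∈ U, (∑ a ∈ A, M a b + ∑ c ∈ C, M c b)) ^ 2 := by
    refine pow_le_pow_left₀ (by positivity) ?_ 2
    rw [Finset.sum_add_distrib]
    linarith [hsum u, hsum v]
  have hup : (2 * m ^ 2) ^ 2 ≤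
      Fintype.card V * (2 * ((d : ℝ) ^ 2 + d ^ 2 * K) + 2 * (d * K ^ 2)) := by
    refine hlow.trans (hcs.trans (mul_le_mul hUn ?_ ?_ (Nat.cast_nonneg _)))
    · rw [hexp]
      linarith
    · exact Finset.sum_nonneg fun _ _ => sq_nonneg _
  have hd' : (0 : ℝ) < d := by exact_mod_cast hd
  have e1 : (Fintype.card V : ℝ) * (d : ℝ) ^ 2 ≤ d ^ 4 / 100 := by
    nlinarith [mul_le_mul_of_nonneg_right hn (sq_nonneg (d : ℝ))]
  have e2 : (Fintype.card V : ℝ) * ((d : ℝ) ^ 2 * K) ≤ 3 / 2 * d ^ 4 := by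
    nlinarith [mul_le_mul_of_nonneg_right hnK (sq_nonneg (d : ℝ))]
  have e3 : (Fintype.card V : ℝ) * (d * K ^ 2) ≤ 3 / 200 * d ^ 4 := by
    calc (Fintype.card V : ℝ) * (d * K ^ 2) = (Fintype.card V * K) * (d * K) := by ring
      _ ≤ (3 / 2 * (d : ℝ) ^ 2) * (d * (d / 100)) := by
          refine mul_le_mul hnK ?_ (by positivity) (by positivity)
          exact mul_le_mul_of_nonneg_left (by linarith) hd'.le
      _ = 3 / 200 * d ^ 4 := by ring
  have e4 : (0 : ℝ) < (d : ℝ) ^ 4 := by positivity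
  have e5 : (2 * m ^ 2) ^ 2 = 4 * (49 / 50) ^ 4 * (d : ℝ) ^ 4 := by rw [hm]; ring
  -- The contradiction is numerical: `4 (49/50)⁴ > 3.68`, while `e1`, `e2`, `e3` bound the right
  -- side by `3.05 d⁴`.
  rw [e5] at hup
  norm_num at hup
  linarith

/-- Greedy embedding: a regular graph of small codegrees contains every small buildable graph as
an induced subgraph. -/
theorem Buildable.exists_inducedOn {W : Type*} [DecidableEq W] {H : SimpleGraph W}
    {T : Finset W} (hT : Buildable H T) [Nonempty V]
    (hreg : ∀ v, G.degree v = d) (hd : 0 < d)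
    (hK : ∀ u v, u ≠ v → ((G.neighborFinset u ∩ G.neighborFinset v).card : ℝ) ≤ K)
    (hK0 : 0 ≤ K) (hKd : 100 * K ≤ d) (hnK : Fintype.card V * K ≤ 3 / 2 * (d : ℝ) ^ 2)
    (hn : 100 * (Fintype.card V : ℝ) ≤ (d : ℝ) ^ 2)
    (hS : 50 * (T.card + T.card * K) ≤ d) (hSn : T.card * (d + 1) < Fintype.card V) :
    ∃ f : W → V, InducedOn H G T f := by
  have hmono : ∀ {T T' : Finset W}, T ⊆ T' → 50 * (T'.card + T'.card * K) ≤ d →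
      T'.card * (d + 1) < Fintype.card V →
      50 * (T.card + T.card * K) ≤ d ∧ T.card * (d + 1) < Fintype.card V := by
    intro T T' h h1 h2
    have hc := Finset.card_le_card h
    have hc' : (T.card : ℝ) ≤ T'.card := by exact_mod_cast hc
    have := mul_le_mul_of_nonneg_right hc' hK0
    exact ⟨by linarith, (Nat.mul_le_mul_right _ hc).trans_lt h2⟩
  have himg : ∀ (T : Finset W) (f : W → V), 50 * (T.card + T.card * K) ≤ d →
      50 * ((T.image f).card + (T.image f).card * K) ≤ d := by
    intro T f h
    have hc' : ((T.image f).card : ℝ) ≤ T.card := by exact_mod_cast Finset.card_image_le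
    have := mul_le_mul_of_nonneg_right hc' hK0
    linarith
  have hd' : (0 : ℝ) < d := by exact_mod_cast hd
  induction hT with
  | empty => exact ⟨fun _ => Classical.arbitrary V, by simp [InducedOn]⟩
  | isolated T x _ hx hadj ih =>
    obtain ⟨h1, h2⟩ := hmono (Finset.subset_insert x T) hS hSn
    obtain ⟨f, hf⟩ := ih h1 h2
    -- The closed neighbourhoods of the occupied vertices, of size `d + 1` each, do not cover `V`.
    obtain ⟨p, hp⟩ : ∃ p, p ∉ (T.image f).biUnion fun v => insert v (G.neighborFinset v) := by
      by_contra! hcon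
      have hle : Fintype.card V ≤ (T.image f).card * (d + 1) := by
        rw [← Finset.card_univ]
        refine (Finset.card_le_card fun p _ => hcon p).trans
          (Finset.card_biUnion_le_card_mul _ _ _ fun v _ => ?_)
        exact (Finset.card_insert_le _ _).trans
          (by rw [card_neighborFinset_eq_degree, hreg])
      have := Nat.mul_le_mul_right (d + 1) (Finset.card_image_le (s := T) (f := f))
      omega
    simp only [Finset.mem_biUnion, Finset.mem_image, Finset.mem_insert, mem_neighborFinset,
      not_exists, not_and, not_or, forall_exists_index, and_imp, forall_apply_eq_imp_iff₂] at hp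
    refine ⟨_, hf.insert hx (p := p) (fun y hy => (hp y hy).1) fun y hy => ?_⟩
    exact iff_of_false (hadj y hy) fun h => (hp y hy).2 h.symm
  | pendant T x u _ hx hu hadj ih =>
    obtain ⟨h1, h2⟩ := hmono (Finset.subset_insert x T) hS hSn
    obtain ⟨f, hf⟩ := ih h1 h2
    obtain ⟨p, hp⟩ : (privateNbrs G (T.image f) (f u)).Nonempty := by
      rw [← Finset.card_pos, ← Nat.cast_pos (α := ℝ)]
      have := le_card_privateNbrs hreg hK hK0 (T.image f) (f u)
      have := himg T f h1
      linarith
    rw [mem_privateNbrs] at hp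
    refine ⟨_, hf.insert hx (p := p) (fun y hy e => hp.2.1 (e ▸ Finset.mem_image_of_mem f hy))
      fun y hy => ?_⟩
    rw [hadj y hy]
    constructor
    · rintro rfl
      exact hp.1.symm
    · intro h
      by_contra hne
      exact hp.2.2 (f y) (Finset.mem_image_of_mem f hy)
        (fun e => hne (hf.1 hy hu e)) h.symm
  | ear T u v a b c _ hu hv huv ha hb hc hac hab hbc hnac hTa hTb hTc ih =>
    obtain ⟨h1, h2⟩ := hmono (((Finset.subset_insert a T).trans (Finset.subset_insert c _)).trans
      (Finset.subset_insert b _)) hS hSn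
    obtain ⟨f, hf⟩ := ih h1 h2
    obtain ⟨p, q, r, hp, hr, hq, hpq, hrq, hpr⟩ := exists_ear hreg hd hK hK0 hKd hnK hn
      (himg T f h1) (Finset.mem_image_of_mem f hv)
      (fun e => huv (hf.1 hu hv e))
    rw [mem_privateNbrs] at hp hr
    have hmem : ∀ {y}, y ∈ T → f y ∈ T.image f := fun hy => Finset.mem_image_of_mem f hy
    have priv : ∀ {w x : V} {z : W}, z ∈ T → w = f z → (G.Adj w x ∧ x ∉ T.image f ∧
        ∀ v ∈ T.image f, v ≠ w → ¬ G.Adj v x) → ∀ y ∈ T, (y = z ↔ G.Adj x (f y)) := by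
      rintro w x z hz rfl hx y hy
      constructor
      · rintro rfl
        exact hx.1.symm
      · intro h
        by_contra hne
        exact hx.2.2 (f y) (hmem hy) (fun e => hne (hf.1 hy hz e)) h.symm
    -- The outer vertices `a` and `c` go in first and the middle vertex `b` last, so that its two
    -- neighbours are already present.
    have s1 := hf.insert ha (p := p) (fun y hy e => hp.2.1 (e ▸ hmem hy))
      fun y hy => (hTa y hy).trans (priv hu rfl hp y hy)
    have hca : c ∉ insert a T := by simp [hac.symm, hc]
    have hba : b ≠ a := hab.ne'
    have hrp : r ≠ p := fun e => hrq.ne (by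
      exact absurd (e ▸ hr.1) (hp.2.2 (f v) (hmem hv) fun e => huv (hf.1 hu hv e.symm)))
    have hne : ∀ {y}, y ∈ T → y ≠ a := fun hy e => ha (e ▸ hy)
    have hnc : ∀ {y}, y ∈ T → y ≠ c := fun hy e => hc (e ▸ hy)
    have s2 := s1.insert hca (p := r) (fun y hy => by
        rw [Finset.mem_insert] at hy
        rcases hy with rfl | hy
        · rwa [Function.update_self]
        · rw [Function.update_of_ne (hne hy)]
          exact fun e => hr.2.1 (e ▸ hmem hy)) fun y hy => by
        rw [Finset.mem_insert] at hy
        rcases hy with rfl | hy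
        · rw [Function.update_self]
          exact iff_of_false (fun h => hnac h.symm) fun h => hpr h.symm
        · rw [Function.update_of_ne (hne hy)]
          exact (hTc y hy).trans (priv hv rfl hr y hy)
    have hbca : b ∉ insert c (insert a T) := by simp [hba, hbc.ne, hb]
    refine ⟨_, s2.insert hbca (p := q) (fun y hy => ?_) fun y hy => ?_⟩
    · rw [Finset.mem_insert, Finset.mem_insert] at hy
      rcases hy with rfl | rfl | hy
      · rw [Function.update_self]
        exact hrq.ne'
      · rw [Function.update_of_ne hac, Function.update_self]
        exact hpq.ne'
      · rw [Function.update_of_ne (hnc hy), Function.update_of_ne (hne hy)]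
        exact fun e => hq.1 (e ▸ hmem hy)
    · rw [Finset.mem_insert, Finset.mem_insert] at hy
      rcases hy with rfl | rfl | hy
      · rw [Function.update_self]
        exact iff_of_true hbc hrq.symm
      · rw [Function.update_of_ne hac, Function.update_self]
        exact iff_of_true hab.symm hpq.symm
      · rw [Function.update_of_ne (hnc hy), Function.update_of_ne (hne hy)]
        exact iff_of_false (hTb y hy) fun h => hq.2 (f y) (hmem hy) h.symm

end Greedy

end SimpleGraph

/-! ### Adjacency in the sparsified grid -/

theorem gridEdge_cases {L : ℕ} (e : GridEdge L) :
    (e.1.2.1.val = e.1.1.1.val + 1 ∧ e.1.2.2.val = e.1.1.2.val) ∨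
      (e.1.2.1.val = e.1.1.1.val ∧ e.1.2.2.val = e.1.1.2.val + 1) := by
  obtain ⟨⟨⟨i, j⟩, ⟨k, l⟩⟩, hadj, hle⟩ := e
  simp only [squareGrid, SimpleGraph.boxProd_adj, SimpleGraph.pathGraph_adj] at hadj
  simp only [Prod.mk_le_mk, Fin.le_def] at hle
  simp only [Fin.ext_iff] at hadj
  dsimp only
  omega

instance gridEdge_finite (L : ℕ) : Finite (GridEdge L) := by
  unfold GridEdge
  infer_instance

theorem linePoint_zero {L : ℕ} (e : GridEdge L) : linePoint e 0 = Sum.inl e.1.1 := rfl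

theorem linePoint_inner {L : ℕ} (e : GridEdge L) {i : ℕ} (h0 : 0 < i) (h : i < L) :
    linePoint e i = Sum.inr (e, ⟨i - 1, by omega⟩) := by
  unfold linePoint
  rw [if_neg h0.ne', dif_pos (by omega)]

theorem linePoint_last {L : ℕ} (e : GridEdge L) (hL : 0 < L) :
    linePoint e L = Sum.inl e.1.2 := by
  unfold linePoint
  rw [if_neg hL.ne', dif_neg (by omega)]

theorem linePoint_cases {L : ℕ} (e : GridEdge L) (i : ℕ) (hi : i ≤ L) (hL : 0 < L) :
    (i = 0 ∧ linePoint e i = Sum.inl e.1.1) ∨ (i = L ∧ linePoint e i = Sum.inl e.1.2) ∨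
      ∃ h : i - 1 < L - 1, 0 < i ∧ linePoint e i = Sum.inr (e, ⟨i - 1, h⟩) := by
  rcases Nat.eq_zero_or_pos i with rfl | h0
  · exact Or.inl ⟨rfl, linePoint_zero e⟩
  · rcases hi.eq_or_lt with rfl | hlt
    · exact Or.inr (Or.inl ⟨rfl, linePoint_last e hL⟩)
    · exact Or.inr (Or.inr ⟨by omega, h0, linePoint_inner e h0 hlt⟩)

theorem sparsifiedGrid_adj {L : ℕ} {x y : SparsifiedGridVertex L} :
    (sparsifiedGrid L).Adj x y ↔ x ≠ y ∧ ∃ (e : GridEdge L) (i : ℕ), i < L ∧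
      ((x = linePoint e i ∧ y = linePoint e (i + 1)) ∨
        (y = linePoint e i ∧ x = linePoint e (i + 1))) := by
  simp only [sparsifiedGrid, SimpleGraph.fromEdgeSet_adj, Set.mem_ofPred_eq, Sym2.eq_iff]
  constructor
  · rintro ⟨⟨e, i, hi, h⟩, hne⟩
    exact ⟨hne, e, i, hi, h.imp id fun h => ⟨h.2, h.1⟩⟩
  · rintro ⟨hne, e, i, hi, h⟩
    exact ⟨⟨e, i, hi, h.imp id fun h => ⟨h.2, h.1⟩⟩, hne⟩

theorem not_sparsifiedGrid_adj_inl_inl {L : ℕ} (hL : 2 ≤ L) (p q : Fin L × Fin L) :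
    ¬ (sparsifiedGrid L).Adj (Sum.inl p) (Sum.inl q) := by
  rw [sparsifiedGrid_adj]
  rintro ⟨-, e, i, hi, h⟩
  have h1 := linePoint_cases e i hi.le (by omega)
  have h2 := linePoint_cases e (i + 1) hi (by omega)
  rcases h with ⟨h, h'⟩ | ⟨h, h'⟩ <;> rw [← h] at h1 <;> rw [← h'] at h2 <;>
    simp at h1 h2 <;> omega

theorem sparsifiedGrid_adj_inr_inr {L : ℕ} (e f : GridEdge L) (j k : Fin (L - 1)) :
    (sparsifiedGrid L).Adj (Sum.inr (e, j)) (Sum.inr (f, k)) ↔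
      e = f ∧ (j.val + 1 = k.val ∨ k.val + 1 = j.val) := by
  have hj := j.2
  have hk := k.2
  rw [sparsifiedGrid_adj]
  constructor
  · rintro ⟨-, g, i, hi, h⟩
    have h1 := linePoint_cases g i hi.le (by omega)
    have h2 := linePoint_cases g (i + 1) hi (by omega)
    rcases h with ⟨h, h'⟩ | ⟨h, h'⟩ <;> rw [← h] at h1 <;> rw [← h'] at h2 <;>
      simp [Fin.ext_iff] at h1 h2
    · obtain ⟨_, rfl, _, h1⟩ := h1
      obtain ⟨rfl, _, h2⟩ := h2
      exact ⟨rfl, by omega⟩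
    · obtain ⟨_, rfl, _, h1⟩ := h1
      obtain ⟨rfl, _, h2⟩ := h2
      exact ⟨rfl, by omega⟩
  · have key : ∀ a : ℕ, ∀ h : a < L - 1, linePoint e (a + 1) = Sum.inr (e, ⟨a, h⟩) := fun a h =>
      linePoint_inner e (by omega) (by omega)
    rintro ⟨rfl, h⟩
    refine ⟨?_, e, ?_⟩
    · simp only [ne_eq, Sum.inr.injEq, Prod.mk.injEq, true_and, Fin.ext_iff]
      omega
    · rcases h with h | h
      · refine ⟨j + 1, by omega, Or.inl ⟨(key _ hj).symm, ?_⟩⟩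
        rw [key _ (by omega)]
        simp [h]
      · refine ⟨k + 1, by omega, Or.inr ⟨(key _ hk).symm, ?_⟩⟩
        rw [key _ (by omega)]
        simp [h]

theorem sparsifiedGrid_adj_inr_inl {L : ℕ} (e : GridEdge L) (j : Fin (L - 1)) (p : Fin L × Fin L) :
    (sparsifiedGrid L).Adj (Sum.inr (e, j)) (Sum.inl p) ↔
      (j.val = 0 ∧ p = e.1.1) ∨ (j.val + 2 = L ∧ p = e.1.2) := by
  have hj := j.2
  rw [sparsifiedGrid_adj]
  constructor
  · rintro ⟨-, g, i, hi, h⟩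
    have h1 := linePoint_cases g i hi.le (by omega)
    have h2 := linePoint_cases g (i + 1) hi (by omega)
    rcases h with ⟨h, h'⟩ | ⟨h, h'⟩ <;> rw [← h] at h1 <;> rw [← h'] at h2 <;>
      simp [Fin.ext_iff] at h1 h2
    · obtain ⟨_, rfl, _, h1⟩ := h1
      exact Or.inr ⟨by omega, h2.2⟩
    · obtain ⟨rfl, _, h2⟩ := h2
      rcases h1 with h1 | h1
      · exact Or.inl ⟨by omega, h1.2⟩
      · omega
  · rintro (⟨h, rfl⟩ | ⟨h, rfl⟩)
    · refine ⟨by simp, e, 0, by omega, Or.inr ⟨rfl, ?_⟩⟩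
      rw [linePoint_inner e (by omega) (by omega)]
      simp [Fin.ext_iff, h]
    · refine ⟨by simp, e, j + 1, by omega, Or.inl ⟨?_, ?_⟩⟩
      · rw [linePoint_inner e (by omega) (by omega)]
        simp
      · rw [show j.val + 1 + 1 = L by omega, linePoint_last e (by omega)]

/-! ### Building the sparsified grid line by line for `L ≥ 4` -/

open Classical in
/-- The vertices of the sparsified grid without the inner vertices of all lines outside `E`, except
for the first `k` inner vertices of the line of `e`. -/
noncomputable def partialGrid {L : ℕ} [Fintype (SparsifiedGridVertex L)] (E : Finset (GridEdge L))
    (e : GridEdge L) (k : ℕ) : Finset (SparsifiedGridVertex L) :=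
  Finset.univ.filter fun x => ∀ f j, x = Sum.inr (f, j) → f ∈ E ∨ (f = e ∧ j.val < k)

section

variable {L : ℕ} [Fintype (SparsifiedGridVertex L)] {E : Finset (GridEdge L)}
  {e : GridEdge L} {k : ℕ}

theorem inl_mem_partialGrid (p : Fin L × Fin L) : Sum.inl p ∈ partialGrid E e k := by
  simp [partialGrid]

theorem inr_mem_partialGrid {f : GridEdge L} {j : Fin (L - 1)} :
    Sum.inr (f, j) ∈ partialGrid E e k ↔ f ∈ E ∨ (f = e ∧ j.val < k) := by
  simp only [partialGrid, Finset.mem_filter, Finset.mem_univ, true_and, Sum.inr.injEq,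
    Prod.mk.injEq]
  exact ⟨fun h => h f j ⟨rfl, rfl⟩, by rintro h _ _ ⟨rfl, rfl⟩; exact h⟩

open Classical in
theorem partialGrid_succ (h : k < L - 1) :
    partialGrid E e (k + 1) = insert (Sum.inr (e, ⟨k, h⟩)) (partialGrid E e k) := by
  ext (p | ⟨f, j⟩)
  · simp [inl_mem_partialGrid]
  · simp only [Finset.mem_insert, inr_mem_partialGrid, Sum.inr.injEq, Prod.mk.injEq, Fin.ext_iff]
    by_cases hf : f = e <;> simp [hf]
    by_cases hE : e ∈ E <;> simp [hE]
    omega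

open Classical in
theorem partialGrid_last : partialGrid E e (L - 1) = partialGrid (insert e E) e 0 := by
  ext (p | ⟨f, j⟩)
  · simp [inl_mem_partialGrid]
  · simp only [inr_mem_partialGrid, Finset.mem_insert]
    simp [j.2, or_comm]

theorem linePoint_mem_partialGrid (h : k < L - 1) : linePoint e k ∈ partialGrid E e k := by
  rcases linePoint_cases e k (by omega) (by omega) with ⟨-, h1⟩ | ⟨-, h1⟩ | ⟨h0, h2, h1⟩ <;> rw [h1]
  · exact inl_mem_partialGrid _
  · exact inl_mem_partialGrid _
  · rw [inr_mem_partialGrid]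
    exact Or.inr ⟨rfl, by dsimp only; omega⟩

/-- The condition `k + 2 < L` says that inner vertex `k` is not the last one, so the far endpoint of
the line, which is already present, is not its neighbour. Only its predecessor on the line remains.
-/
theorem sparsifiedGrid_adj_iff_eq_linePoint (he : e ∉ E) (hk : k + 2 < L)
    {y : SparsifiedGridVertex L} (hy : y ∈ partialGrid E e k) :
    (sparsifiedGrid L).Adj (Sum.inr (e, ⟨k, by omega⟩)) y ↔ y = linePoint e k := by
  rcases y with p | ⟨f, j⟩
  · rw [sparsifiedGrid_adj_inr_inl]
    rcases Nat.eq_zero_or_pos k with rfl | h0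
    · rw [linePoint_zero, Sum.inl.injEq]
      simp only [true_and, or_iff_left_iff_imp]
      omega
    · rw [linePoint_inner e h0 (by omega)]
      simp only [reduceCtorEq, iff_false]
      omega
  · rw [inr_mem_partialGrid] at hy
    rw [sparsifiedGrid_adj_inr_inr]
    rcases Nat.eq_zero_or_pos k with rfl | h0
    · rw [linePoint_zero]
      simp only [reduceCtorEq, iff_false]
      rintro ⟨rfl, h⟩
      simp only [he, true_and, false_or] at hy
      omega
    · rw [linePoint_inner e h0 (by omega)]
      simp only [Sum.inr.injEq, Prod.mk.injEq, Fin.ext_iff]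
      constructor
      · rintro ⟨rfl, h⟩
        simp only [he, true_and, false_or] at hy
        exact ⟨rfl, by omega⟩
      · rintro ⟨rfl, h⟩
        exact ⟨rfl, by omega⟩

open Classical in
theorem buildable_partialGrid_empty (hL : 2 ≤ L) (e : GridEdge L) :
    (sparsifiedGrid L).Buildable (partialGrid ∅ e 0) := by
  have key : ∀ Q : Finset (Fin L × Fin L),
      (sparsifiedGrid L).Buildable (Q.image (Sum.inl : _ → SparsifiedGridVertex L)) := by
    intro Q
    induction Q using Finset.induction_on with
    | empty => exact .empty
    | insert q Q hq ih =>
      rw [Finset.image_insert]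
      refine .isolated _ _ ih ?_ ?_
      · simpa using hq
      · rintro y hy
        obtain ⟨p, -, rfl⟩ := Finset.mem_image.1 hy
        exact not_sparsifiedGrid_adj_inl_inl hL q p
  convert key Finset.univ
  ext (p | ⟨f, j⟩)
  · simp [inl_mem_partialGrid]
  · simp [inr_mem_partialGrid]

open Classical in
theorem buildable_partialGrid_of_le (he : e ∉ E)
    (h : (sparsifiedGrid L).Buildable (partialGrid E e 0)) (hk : k + 3 ≤ L) :
    (sparsifiedGrid L).Buildable (partialGrid E e k) := by
  induction k with
  | zero => exact h
  | succ k ih =>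
    rw [partialGrid_succ (by omega)]
    refine .pendant _ _ (linePoint e k) (ih (by omega)) ?_
      (linePoint_mem_partialGrid (by omega))
      fun y hy => sparsifiedGrid_adj_iff_eq_linePoint he (by omega) hy
    simp [inr_mem_partialGrid, he]

-- With `L = k + 4` the inner vertices have indices `0, …, k + 2`. The first `k` are pendant; the
-- last three form an ear from the end of that partial path to the far endpoint.
open Classical in
theorem buildable_partialGrid_insert (hL : 4 ≤ L) (he : e ∉ E)
    (h : (sparsifiedGrid L).Buildable (partialGrid E e 0)) :
    (sparsifiedGrid L).Buildable (partialGrid (insert e E) e 0) := by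
  obtain ⟨k, hk⟩ := Nat.exists_eq_add_of_le' hL
  have hlast : partialGrid E e (L - 1) = partialGrid E e (k + 2 + 1) :=
    congrArg (partialGrid E e) (by omega)
  have hnot : ∀ i (hi : i < L - 1), k ≤ i → Sum.inr (e, ⟨i, hi⟩) ∉ partialGrid E e k := by
    intro i hi hki
    rw [inr_mem_partialGrid]
    simp [he, hki]
  have hnadj : ∀ i (hi : i < L - 1), k < i → ∀ f j, Sum.inr (f, j) ∈ partialGrid E e k →
      ¬ (sparsifiedGrid L).Adj (Sum.inr (e, ⟨i, hi⟩)) (Sum.inr (f, j)) := by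
    intro i hi hki f j hy
    rw [inr_mem_partialGrid] at hy
    rw [sparsifiedGrid_adj_inr_inr]
    rintro ⟨rfl, h⟩
    simp only [he, true_and, false_or] at hy h
    omega
  -- The swap puts the middle vertex of the ear outermost, as in `Buildable.ear`.
  rw [← partialGrid_last, hlast, partialGrid_succ (by omega), partialGrid_succ (by omega),
    partialGrid_succ (by omega), Finset.insert_comm]
  refine .ear _ (linePoint e k) (Sum.inl e.1.2) _ _ _
    (buildable_partialGrid_of_le he h (by omega)) (linePoint_mem_partialGrid (by omega))
    (inl_mem_partialGrid _) ?_ (hnot _ _ le_rfl) (hnot _ _ (by omega)) (hnot _ _ (by omega)) ?_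
    ((sparsifiedGrid_adj_inr_inr _ _ _ _).2 ⟨rfl, Or.inl rfl⟩)
    ((sparsifiedGrid_adj_inr_inr _ _ _ _).2 ⟨rfl, Or.inl rfl⟩)
    ?_ (fun y hy => sparsifiedGrid_adj_iff_eq_linePoint he (by omega) hy) ?_ ?_
  -- For `k = 0` the ear joins the two endpoints of the grid edge, which are distinct; otherwise it
  -- starts at an inner vertex.
  · rcases linePoint_cases e k (by omega) (by omega) with ⟨-, h1⟩ | ⟨h0, h1⟩ | ⟨h0, h2, h1⟩
    · rw [h1, ne_eq, Sum.inl.injEq]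
      have hne := gridEdge_cases e
      intro h
      rw [h] at hne
      omega
    · omega
    · simp [h1]
  · simp only [ne_eq, Sum.inr.injEq, Prod.mk.injEq, Fin.ext_iff]
    omega
  · rw [sparsifiedGrid_adj_inr_inr]
    dsimp only
    omega
  · rintro (p | ⟨f, j⟩) hy
    · rw [sparsifiedGrid_adj_inr_inl]
      dsimp only
      omega
    · exact hnadj _ _ (by omega) f j hy
  · rintro (p | ⟨f, j⟩) hy
    · rw [sparsifiedGrid_adj_inr_inl, Sum.inl.injEq]
      dsimp only
      constructor
      · rintro (h | h)
        · omega
        · exact h.2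
      · exact fun h => Or.inr ⟨by omega, h⟩
    · exact iff_of_false (hnadj _ _ (by omega) f j hy) (by simp)

open Classical in
theorem buildable_sparsifiedGrid (hL : 4 ≤ L) : (sparsifiedGrid L).Buildable Finset.univ := by
  have hfin := Fintype.ofFinite (GridEdge L)
  have key : ∀ E : Finset (GridEdge L), ∀ e, (sparsifiedGrid L).Buildable (partialGrid E e 0) := by
    intro E
    have hind : ∀ e e', partialGrid E e 0 = partialGrid E e' 0 := by
      intro e e'
      simp [partialGrid]
    induction E using Finset.induction_on with
    | empty => exact fun e => buildable_partialGrid_empty (by omega) e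
    | insert e E he ih =>
      intro e'
      rw [hind e' e]
      exact buildable_partialGrid_insert hL he (ih (fun e e' => by simp [partialGrid]) e)
  have e : GridEdge L := ⟨((⟨0, by omega⟩, ⟨0, by omega⟩), (⟨1, by omega⟩, ⟨0, by omega⟩)), by
    simp [squareGrid, SimpleGraph.boxProd_adj, SimpleGraph.pathGraph_adj, Prod.le_def]⟩
  convert key Finset.univ e
  ext (p | ⟨f, j⟩)
  · simp [inl_mem_partialGrid]
  · simp [inr_mem_partialGrid]

end

/-! ### The cases `L = 2` and `L = 3` inside the square lattice -/

/-- The square lattice on `ℕ × ℕ`. -/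
def squareLattice : SimpleGraph (ℕ × ℕ) where
  Adj p q := (p.1 = q.1 ∧ (p.2 + 1 = q.2 ∨ q.2 + 1 = p.2)) ∨
    (p.2 = q.2 ∧ (p.1 + 1 = q.1 ∨ q.1 + 1 = p.1))
  symm := ⟨fun p q h => by omega⟩
  loopless := ⟨fun p h => by omega⟩

theorem squareLattice_adj {p q : ℕ × ℕ} : squareLattice.Adj p q ↔
    (p.1 = q.1 ∧ (p.2 + 1 = q.2 ∨ q.2 + 1 = p.2)) ∨
      (p.2 = q.2 ∧ (p.1 + 1 = q.1 ∨ q.1 + 1 = p.1)) := Iff.rfl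

instance : DecidableRel squareLattice.Adj := fun p q =>
  inferInstanceAs (Decidable ((p.1 = q.1 ∧ (p.2 + 1 = q.2 ∨ q.2 + 1 = p.2)) ∨
    (p.2 = q.2 ∧ (p.1 + 1 = q.1 ∨ q.1 + 1 = p.1))))

/-- The position of the vertices of the sparsified grid in the square lattice. -/
def gridPosition {L : ℕ} : SparsifiedGridVertex L → ℕ × ℕ
  | Sum.inl p => (L * p.1, L * p.2)
  | Sum.inr (e, k) =>
    if e.1.1.1.val < e.1.2.1.val then (L * e.1.1.1 + k + 1, L * e.1.1.2)
    else (L * e.1.1.1, L * e.1.1.2 + k + 1)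

theorem gridEdge_ext {L : ℕ} {e f : GridEdge L} : e = f ↔
    e.1.1.1.val = f.1.1.1.val ∧ e.1.1.2.val = f.1.1.2.val ∧
      e.1.2.1.val = f.1.2.1.val ∧ e.1.2.2.val = f.1.2.2.val := by
  constructor
  · rintro rfl
    simp
  · rintro ⟨h1, h2, h3, h4⟩
    exact Subtype.ext (Prod.ext (Prod.ext (Fin.ext h1) (Fin.ext h2))
      (Prod.ext (Fin.ext h3) (Fin.ext h4)))

/-- Fixing `L` to a numeral makes all coordinates linear, so linear arithmetic settles the
comparison. -/
theorem gridPosition_injective {L : ℕ} (hL : L = 2 ∨ L = 3) :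
    Function.Injective (gridPosition (L := L)) := by
  rintro (⟨i, j⟩ | ⟨e, k⟩) (⟨i', j'⟩ | ⟨f, l⟩) h
  all_goals try have he := gridEdge_cases e
  all_goals try have hk := k.2
  all_goals try have hf := gridEdge_cases f
  all_goals try have hl := l.2
  all_goals simp only [gridPosition] at h
  all_goals try split_ifs at h
  all_goals simp only [Prod.mk.injEq] at h
  all_goals simp only [Sum.inl.injEq, Sum.inr.injEq, Prod.mk.injEq, reduceCtorEq, gridEdge_ext,
    Fin.ext_iff]
  all_goals rcases hL with rfl | rfl <;> omega

theorem squareLattice_adj_gridPosition {L : ℕ} (hL : L = 2 ∨ L = 3) (x y : SparsifiedGridVertex L) :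
    squareLattice.Adj (gridPosition x) (gridPosition y) ↔ (sparsifiedGrid L).Adj x y := by
  have hinl : ∀ (e : GridEdge L) k i j, squareLattice.Adj (gridPosition (Sum.inr (e, k)))
      (gridPosition (Sum.inl (i, j))) ↔ (sparsifiedGrid L).Adj (Sum.inr (e, k)) (Sum.inl (i, j)) := by
    intro e k i j
    have he := gridEdge_cases e
    have hk := k.2
    rw [sparsifiedGrid_adj_inr_inl, squareLattice_adj]
    simp only [gridPosition, Prod.ext_iff, Fin.ext_iff]
    split_ifs <;> rcases hL with rfl | rfl <;> omega
  rcases x with ⟨i, j⟩ | ⟨e, k⟩ <;> rcases y with ⟨i', j'⟩ | ⟨f, l⟩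
  · refine iff_of_false ?_ (not_sparsifiedGrid_adj_inl_inl (by omega) _ _)
    rw [squareLattice_adj]
    simp only [gridPosition]
    rcases hL with rfl | rfl <;> omega
  · rw [SimpleGraph.adj_comm, hinl, SimpleGraph.adj_comm]
  · exact hinl e k i' j'
  · have he := gridEdge_cases e
    have hf := gridEdge_cases f
    have hk := k.2
    have hl := l.2
    rw [sparsifiedGrid_adj_inr_inr, squareLattice_adj, gridEdge_ext]
    simp only [gridPosition]
    split_ifs <;> rcases hL with rfl | rfl <;> omega

/-- In this list each vertex has at most one neighbour further down the list. -/
def IsForestList {W : Type*} (H : SimpleGraph W) [DecidableRel H.Adj] [DecidableEq W] :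
    List W → Bool
  | [] => true
  | x :: l => IsForestList H l && decide (x ∉ l) && decide ((l.filter fun y => H.Adj x y).length ≤ 1)

theorem buildable_of_isForestList {W : Type*} {H : SimpleGraph W} [DecidableRel H.Adj]
    [DecidableEq W] {l : List W} (h : IsForestList H l = true) : H.Buildable l.toFinset := by
  induction l with
  | nil => exact .empty
  | cons x l ih =>
    simp only [IsForestList, Bool.and_eq_true, decide_eq_true_eq] at h
    obtain ⟨⟨h1, h2⟩, h3⟩ := h
    rw [List.toFinset_cons]
    have hmem : ∀ y, y ∈ l.filter (fun y => H.Adj x y) ↔ y ∈ l ∧ H.Adj x y := by simp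
    rcases Nat.le_one_iff_eq_zero_or_eq_one.1 h3 with h3 | h3
    · rw [List.length_eq_zero_iff] at h3
      refine .isolated _ _ (ih h1) (by simpa) fun y hy hadj => ?_
      have := (hmem y).2 ⟨by simpa using hy, hadj⟩
      simp [h3] at this
    · obtain ⟨u, hu⟩ := List.length_eq_one_iff.1 h3
      simp only [hu, List.mem_singleton] at hmem
      have hul := (hmem u).1 rfl
      refine .pendant _ _ u (ih h1) (by simpa) (by simpa using hul.1) fun y hy => ?_
      rw [hmem y]
      simp only [List.mem_toFinset] at hy
      simp [hy]

/-- The graph is an 8-cycle: a path on five vertices closed by an ear around the corner `(0, 0)`. -/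
theorem buildable_squareLattice_two : ∃ T : Finset (ℕ × ℕ), squareLattice.Buildable T ∧
    T.card ≤ 8 ∧ ∀ x < 3, ∀ y < 3, (x % 2 = 0 ∨ y % 2 = 0) → (x, y) ∈ T := by
  have h := buildable_of_isForestList (H := squareLattice)
    (l := [(0, 2), (1, 2), (2, 0), (2, 1), (2, 2)]) (by decide)
  have h1 := SimpleGraph.Buildable.ear _ (2, 0) (0, 2) (1, 0) (0, 0) (0, 1) h (by decide)
    (by decide) (by decide) (by decide) (by decide) (by decide) (by decide) (by decide) (by decide)
    (by decide) (by decide) (by decide) (by decide)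
  exact ⟨_, h1, by decide, by decide⟩

/-- Removing three vertices around each of the four outer corners leaves a tree on 21 vertices
rooted at `(3, 3)`; the corners return as four ears. -/
theorem buildable_squareLattice_three : ∃ T : Finset (ℕ × ℕ), squareLattice.Buildable T ∧
    T.card ≤ 33 ∧ ∀ x < 7, ∀ y < 7, (x % 3 = 0 ∨ y % 3 = 0) → (x, y) ∈ T := by
  have h := buildable_of_isForestList (H := squareLattice)
    (l := [(6, 4), (6, 2), (6, 3), (5, 3), (4, 3), (0, 4), (0, 2), (0, 3), (1, 3), (2, 3),
      (4, 6), (2, 6), (3, 6), (3, 5), (3, 4), (4, 0), (2, 0), (3, 0), (3, 1), (3, 2), (3, 3)])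
    (by decide)
  have h1 := SimpleGraph.Buildable.ear _ (2, 0) (0, 2) (1, 0) (0, 0) (0, 1) h (by decide)
    (by decide) (by decide) (by decide) (by decide) (by decide) (by decide) (by decide) (by decide)
    (by decide) (by decide) (by decide) (by decide)
  have h2 := SimpleGraph.Buildable.ear _ (4, 0) (6, 2) (5, 0) (6, 0) (6, 1) h1 (by decide)
    (by decide) (by decide) (by decide) (by decide) (by decide) (by decide) (by decide) (by decide)
    (by decide) (by decide) (by decide) (by decide)
  have h3 := SimpleGraph.Buildable.ear _ (0, 4) (2, 6) (0, 5) (0, 6) (1, 6) h2 (by decide)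
    (by decide) (by decide) (by decide) (by decide) (by decide) (by decide) (by decide) (by decide)
    (by decide) (by decide) (by decide) (by decide)
  have h4 := SimpleGraph.Buildable.ear _ (6, 4) (4, 6) (6, 5) (6, 6) (5, 6) h3 (by decide)
    (by decide) (by decide) (by decide) (by decide) (by decide) (by decide) (by decide) (by decide)
    (by decide) (by decide) (by decide) (by decide)
  exact ⟨_, h4, by decide, by decide⟩

theorem gridPosition_mem_range {L : ℕ} (hL : L = 2 ∨ L = 3) (x : SparsifiedGridVertex L) :
    (gridPosition x).1 < L * (L - 1) + 1 ∧ (gridPosition x).2 < L * (L - 1) + 1 ∧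
      ((gridPosition x).1 % L = 0 ∨ (gridPosition x).2 % L = 0) := by
  rcases x with ⟨i, j⟩ | ⟨e, k⟩
  · simp only [gridPosition]
    rcases hL with rfl | rfl <;> omega
  · have he := gridEdge_cases e
    have hk := k.2
    simp only [gridPosition]
    split_ifs <;> rcases hL with rfl | rfl <;> dsimp only <;> omega

/-! ### The sparsified grid in regular graphs of small codegree -/

theorem SimpleGraph.InducedOn.isIndContained {U W V : Type*} {F : SimpleGraph U}
    {H : SimpleGraph W} {G : SimpleGraph V} {T : Finset W} {f : W → V} (hf : InducedOn H G T f)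
    (g : U → W) (hg : Function.Injective g) (hgT : ∀ x, g x ∈ T)
    (hadj : ∀ x y, H.Adj (g x) (g y) ↔ F.Adj x y) : F.IsIndContained G :=
  ⟨⟨⟨fun x => f (g x), fun x y h => hg (hf.1 (hgT x) (hgT y) h)⟩, fun {x y} =>
    (hf.2 _ (hgT x) _ (hgT y)).symm.trans (hadj x y)⟩⟩

theorem sparsifiedGrid_isIndContained {V : Type*} [Fintype V] [DecidableEq V] [Nonempty V]
    {G : SimpleGraph V} [DecidableRel G.Adj] {d s : ℕ} {K : ℝ}
    (hreg : ∀ v, G.degree v = d) (hd : 0 < d)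
    (hK : ∀ u v, u ≠ v → ((G.neighborFinset u ∩ G.neighborFinset v).card : ℝ) ≤ K)
    (hK0 : 0 ≤ K) (hKd : 100 * K ≤ d) (hnK : Fintype.card V * K ≤ 3 / 2 * (d : ℝ) ^ 2)
    (hn : 100 * (Fintype.card V : ℝ) ≤ (d : ℝ) ^ 2)
    (hS : 50 * (s + s * K) ≤ d) (hSn : s * (d + 1) < Fintype.card V) (L : ℕ)
    (hLs : Nat.card (SparsifiedGridVertex L) ≤ s) (hs : 33 ≤ s) :
    (sparsifiedGrid L).IsIndContained G := by
  have main : ∀ {W : Type} [DecidableEq W] {H : SimpleGraph W} {T : Finset W}, H.Buildable T →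
      T.card ≤ s → ∃ f : W → V, SimpleGraph.InducedOn H G T f := by
    intro W _ H T hT hTs
    have hTs' : (T.card : ℝ) ≤ s := by exact_mod_cast hTs
    refine hT.exists_inducedOn hreg hd hK hK0 hKd hnK hn ?_
      ((Nat.mul_le_mul_right _ hTs).trans_lt hSn)
    have := mul_le_mul_of_nonneg_right hTs' hK0
    linarith
  rcases Nat.lt_or_ge L 2 with h | h
  -- For `L ≤ 1` there is at most one vertex, so any map into `V` works.
  · have h1 : IsEmpty (Fin (L - 1)) := ⟨fun i => by have := i.2; omega⟩
    have h2 : Subsingleton (Fin L) := ⟨fun i j => by ext; omega⟩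
    have h3 : Subsingleton (SparsifiedGridVertex L) := by
      refine ⟨?_⟩
      rintro (p | p) (q | q)
      · rw [Subsingleton.elim p q]
      · exact h1.elim q.2
      · exact h1.elim p.2
      · exact h1.elim p.2
    refine ⟨⟨⟨fun _ => Classical.arbitrary V, fun x y _ => ?_⟩, fun {x y} => ?_⟩⟩
    · exact Subsingleton.elim x y
    · obtain rfl := Subsingleton.elim x y
      simp
  rcases Nat.lt_or_ge L 4 with h4 | h4
  · obtain ⟨T, hT, hTs, hmem⟩ : ∃ T : Finset (ℕ × ℕ), squareLattice.Buildable T ∧ T.card ≤ 33 ∧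
        ∀ x : SparsifiedGridVertex L, gridPosition x ∈ T := by
      obtain rfl | rfl : L = 2 ∨ L = 3 := by omega
      · obtain ⟨T, h1, h2, h3⟩ := buildable_squareLattice_two
        refine ⟨T, h1, h2.trans (by norm_num), fun x => ?_⟩
        obtain ⟨h5, h6, h7⟩ := gridPosition_mem_range (Or.inl rfl) x
        exact h3 _ h5 _ h6 h7
      · obtain ⟨T, h1, h2, h3⟩ := buildable_squareLattice_three
        refine ⟨T, h1, h2, fun x => ?_⟩
        obtain ⟨h5, h6, h7⟩ := gridPosition_mem_range (Or.inr rfl) x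
        exact h3 _ h5 _ h6 h7
    obtain ⟨f, hf⟩ := main hT (hTs.trans hs)
    exact hf.isIndContained gridPosition (gridPosition_injective (by omega)) hmem
      (squareLattice_adj_gridPosition (by omega))
  · classical
    have hfin := Fintype.ofFinite (SparsifiedGridVertex L)
    obtain ⟨f, hf⟩ := main (buildable_sparsifiedGrid h4) (by
      rwa [Finset.card_univ, ← Nat.card_eq_fintype_card])
    exact hf.isIndContained id Function.injective_id (fun x => Finset.mem_univ x)
      fun _ _ => Iff.rfl

/-! ### Existence of regular graphs -/

theorem exists_symmetric_finset {n d : ℕ} (hd : d < n) (h : Even (n * d)) :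
    ∃ A : Finset ℕ, A.card = d ∧ ∀ i ∈ A, 0 < i ∧ i < n ∧ n - i ∈ A := by
  obtain ⟨k, hk | hk⟩ := Nat.even_or_odd' d
  · refine ⟨Finset.Icc 1 k ∪ Finset.Ico (n - k) n, ?_, fun i hi => ?_⟩
    · rw [Finset.card_union_of_disjoint, Nat.card_Icc, Nat.card_Ico]
      · omega
      · rw [Finset.disjoint_left]
        intro i hi hi'
        simp only [Finset.mem_Icc, Finset.mem_Ico] at hi hi'
        omega
    · simp only [Finset.mem_union, Finset.mem_Icc, Finset.mem_Ico] at hi ⊢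
      omega
  · have hn : Even n := by
      rcases Nat.even_mul.1 h with h | h
      · exact h
      · exact absurd h (by rw [hk]; simp)
    obtain ⟨m, rfl⟩ := hn
    refine ⟨insert m (Finset.Icc 1 k ∪ Finset.Ico (m + m - k) (m + m)), ?_, fun i hi => ?_⟩
    · rw [Finset.card_insert_of_notMem, Finset.card_union_of_disjoint, Nat.card_Icc, Nat.card_Ico]
      · omega
      · rw [Finset.disjoint_left]
        intro i hi hi'
        simp only [Finset.mem_Icc, Finset.mem_Ico] at hi hi'
        omega
      · simp only [Finset.mem_union, Finset.mem_Icc, Finset.mem_Ico]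
        omega
    · simp only [Finset.mem_insert, Finset.mem_union, Finset.mem_Icc, Finset.mem_Ico] at hi ⊢
      omega

-- This is the circulant graph with the symmetric connection set just found; for odd `d` that set
-- contains the involution `n/2`. Existence ensures that the uniform law is not the zero measure.
open Classical in
theorem exists_isRegularOfDegree {n d : ℕ} (hd : d < n) (h : Even (n * d)) :
    ∃ G : SimpleGraph (Fin n), G.IsRegularOfDegree d := by
  obtain ⟨A, hA, hsymm⟩ := exists_symmetric_finset hd h
  have : NeZero n := ⟨by omega⟩
  have hneg : ∀ v w : Fin n, (w - v).val ∈ A → (v - w).val ∈ A := by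
    intro v w hvw
    obtain ⟨h1, h2, h3⟩ := hsymm _ hvw
    rwa [← neg_sub, Fin.val_neg', Nat.mod_eq_of_lt (by omega)]
  let G : SimpleGraph (Fin n) :=
    { Adj := fun v w => (w - v).val ∈ A
      symm := ⟨fun v w => hneg v w⟩
      loopless := ⟨fun v hv => by
        have := (hsymm _ hv).1
        simp at this⟩ }
  refine ⟨G, fun v => ?_⟩
  rw [← G.card_neighborFinset_eq_degree, ← hA]
  refine Finset.card_bij (fun w _ => (w - v).val) (fun w hw => ?_) (fun w _ w' _ h => ?_)
    fun i hi => ?_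
  · simpa [G] using hw
  · exact sub_left_injective (Fin.ext h)
  · obtain ⟨-, h2, -⟩ := hsymm i hi
    exact ⟨⟨i, h2⟩ + v, by simpa [G] using hi, by simp⟩

/-! ### Switchings -/

namespace SimpleGraph

section Switching

variable {V : Type*}

/-- The graph obtained by replacing the edges `xy`, `ab` by `xa`, `yb`. -/
def switch (G : SimpleGraph V) (x y a b : V) : SimpleGraph V :=
  fromEdgeSet ((G.edgeSet \ {s(x, y), s(a, b)}) ∪ {s(x, a), s(y, b)})

theorem switch_adj {G : SimpleGraph V} {x y a b p q : V} : (G.switch x y a b).Adj p q ↔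
    ((G.Adj p q ∧ s(p, q) ≠ s(x, y) ∧ s(p, q) ≠ s(a, b)) ∨ s(p, q) = s(x, a) ∨ s(p, q) = s(y, b)) ∧
      p ≠ q := by
  simp only [switch, fromEdgeSet_adj, Set.mem_union, Set.mem_sdiff, mem_edgeSet,
    Set.mem_insert_iff, Set.mem_singleton_iff, not_or]

/-- The edges `xy`, `ab` can be replaced by `xa`, `yb`. -/
structure Switchable (G : SimpleGraph V) (x y a b : V) : Prop where
  adj_left : G.Adj x y
  adj_right : G.Adj a b
  ne_left : x ≠ a
  ne_right : y ≠ b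
  not_adj_left : ¬ G.Adj x a
  not_adj_right : ¬ G.Adj y b

theorem Switchable.ne_cross {G : SimpleGraph V} {x y a b : V} (h : G.Switchable x y a b) :
    y ≠ a ∧ x ≠ b :=
  ⟨fun e => h.not_adj_left (e ▸ h.adj_left), fun e => h.not_adj_right (e ▸ h.adj_left.symm)⟩

theorem Switchable.switch_adj_left {G : SimpleGraph V} {x y a b : V} (h : G.Switchable x y a b) :
    (G.switch x y a b).Adj x a :=
  switch_adj.2 ⟨Or.inr (Or.inl rfl), h.ne_left⟩

theorem Switchable.switch_adj_right {G : SimpleGraph V} {x y a b : V} (h : G.Switchable x y a b) :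
    (G.switch x y a b).Adj y b :=
  switch_adj.2 ⟨Or.inr (Or.inr rfl), h.ne_right⟩

/-- A switching is reversible once `x, y, a, b` are known: switchability fixes the status of the
four altered pairs, and all other pairs are untouched. -/
theorem Switchable.eq_of_switch_eq {G G' : SimpleGraph V} {x y a b : V}
    (h : G.Switchable x y a b) (h' : G'.Switchable x y a b)
    (he : G.switch x y a b = G'.switch x y a b) : G = G' := by
  ext p q
  have hpq : (G.switch x y a b).Adj p q ↔ (G'.switch x y a b).Adj p q := by rw [he]
  rw [switch_adj, switch_adj] at hpq
  have congr_adj : ∀ (G : SimpleGraph V) {u v : V}, s(p, q) = s(u, v) → (G.Adj p q ↔ G.Adj u v) :=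
    fun G u v e => by rw [← mem_edgeSet, e, mem_edgeSet]
  by_cases h1 : s(p, q) = s(x, y)
  · rw [congr_adj G h1, congr_adj G' h1]
    exact iff_of_true h.adj_left h'.adj_left
  by_cases h2 : s(p, q) = s(a, b)
  · rw [congr_adj G h2, congr_adj G' h2]
    exact iff_of_true h.adj_right h'.adj_right
  by_cases h3 : s(p, q) = s(x, a)
  · rw [congr_adj G h3, congr_adj G' h3]
    exact iff_of_false h.not_adj_left h'.not_adj_left
  by_cases h4 : s(p, q) = s(y, b)
  · rw [congr_adj G h4, congr_adj G' h4]
    exact iff_of_false h.not_adj_right h'.not_adj_right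
  simp only [ne_eq, h1, not_false_eq_true, h2, and_self, and_true, h3, h4, or_self, or_false] at hpq
  have hG : G.Adj p q → p ≠ q := fun h => h.ne
  have hG' : G'.Adj p q → p ≠ q := fun h => h.ne
  tauto

variable [Fintype V]

-- Each of the four vertices trades exactly one neighbour for a new one.
open Classical in
theorem Switchable.degree_switch {G : SimpleGraph V} {x y a b : V} (h : G.Switchable x y a b)
    (v : V) : (G.switch x y a b).degree v = G.degree v := by
  obtain ⟨h1, h2, h3, h4, h5, h6⟩ := h
  obtain ⟨h7, h8⟩ := Switchable.ne_cross ⟨h1, h2, h3, h4, h5, h6⟩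
  have hxy := h1.ne
  have hab := h2.ne
  have key : ∀ p q : V, G.Adj v p → ¬ G.Adj v q →
      (G.switch x y a b).neighborFinset v = insert q ((G.neighborFinset v).erase p) →
      (G.switch x y a b).degree v = G.degree v := by
    intro p q hp hq e
    rw [← card_neighborFinset_eq_degree, e, Finset.card_insert_of_notMem (by simp [hq]),
      Finset.card_erase_add_one (by simpa using hp), card_neighborFinset_eq_degree]
  by_cases hvx : v = x
  · subst hvx
    refine key y a h1 h5 ?_
    ext w
    simp only [mem_neighborFinset, switch_adj, Finset.mem_insert, Finset.mem_erase, Sym2.eq_iff]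
    grind [SimpleGraph.Adj.ne]
  by_cases hvy : v = y
  · subst hvy
    refine key x b h1.symm h6 ?_
    ext w
    simp only [mem_neighborFinset, switch_adj, Finset.mem_insert, Finset.mem_erase, Sym2.eq_iff]
    grind [SimpleGraph.Adj.ne]
  by_cases hva : v = a
  · subst hva
    refine key b x h2 (fun h => h5 h.symm) ?_
    ext w
    simp only [mem_neighborFinset, switch_adj, Finset.mem_insert, Finset.mem_erase, Sym2.eq_iff]
    grind [SimpleGraph.Adj.ne]
  by_cases hvb : v = b
  · subst hvb
    refine key a y h2.symm (fun h => h6 h.symm) ?_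
    ext w
    simp only [mem_neighborFinset, switch_adj, Finset.mem_insert, Finset.mem_erase, Sym2.eq_iff]
    grind [SimpleGraph.Adj.ne]
  rw [← card_neighborFinset_eq_degree, ← card_neighborFinset_eq_degree]
  congr 1
  ext w
  simp only [mem_neighborFinset, switch_adj, Sym2.eq_iff]
  grind [SimpleGraph.Adj.ne]

open Classical in
/-- The `d`-regular graphs on `V` all of whose edges in `F` are present. -/
noncomputable def regularGraphs (V : Type*) [Fintype V] (d : ℕ) (F : Finset (Sym2 V)) :
    Finset (SimpleGraph V) :=
  Finset.univ.filter fun G => (∀ v, G.degree v = d) ∧ ∀ e ∈ F, e ∈ G.edgeSet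

open Classical in
theorem mem_regularGraphs {d : ℕ} {F : Finset (Sym2 V)} {G : SimpleGraph V} :
    G ∈ regularGraphs V d F ↔ (∀ v, G.degree v = d) ∧ ∀ e ∈ F, e ∈ G.edgeSet := by
  simp only [regularGraphs, Finset.mem_filter, Finset.mem_univ, true_and]

-- Of the `nd` ordered edges `(a, b)`, a bad one has `a` in the closed neighbourhood of `x`, or `b`
-- in that of `y`, or lies over `F`. The first two cases cost `(d + 1) d` each and the last costs `2
-- |F|`.
open Classical in
theorem card_le_card_switchable {d : ℕ} {G : SimpleGraph V} (hG : ∀ v, G.degree v = d) {x y : V}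
    (hxy : G.Adj x y) (F : Finset (Sym2 V)) :
    Fintype.card V * d ≤ (Finset.univ.filter fun p : V × V =>
      G.Switchable x y p.1 p.2 ∧ s(p.1, p.2) ∉ F).card + 2 * F.card + 2 * ((d + 1) * d) := by
  set P := Finset.univ.filter fun p : V × V => G.Switchable x y p.1 p.2 ∧ s(p.1, p.2) ∉ F
  set D := Finset.univ.filter fun p : V × V => G.Adj p.1 p.2
  set A : V → Finset (V × V) := fun z =>
    (insert z (G.neighborFinset z)).biUnion fun a => (G.neighborFinset a).image fun b => (a, b)
  set A' : V → Finset (V × V) := fun z =>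
    (insert z (G.neighborFinset z)).biUnion fun b => (G.neighborFinset b).image fun a => (a, b)
  set Q := F.biUnion fun e => Finset.univ.filter fun p : V × V => s(p.1, p.2) = e
  have hD : D.card = Fintype.card V * d := by
    have : D = Finset.univ.biUnion fun a => (G.neighborFinset a).image fun b => (a, b) := by
      ext ⟨a, b⟩
      simp [D]
    rw [this, Finset.card_biUnion]
    · rw [Finset.sum_congr rfl fun a _ => Finset.card_image_of_injective _
        (Prod.mk_right_injective a)]
      simp [hG, Finset.card_univ]
    · intro a _ b _ hab
      rw [Function.onFun, Finset.disjoint_left]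
      simp only [Finset.mem_image, not_exists, not_and]
      rintro _ ⟨w, _, rfl⟩ z _ e
      exact hab (Prod.ext_iff.1 e).1.symm
  have hcl : ∀ z, (insert z (G.neighborFinset z)).card ≤ d + 1 := fun z =>
    (Finset.card_insert_le _ _).trans (by rw [card_neighborFinset_eq_degree, hG])
  have hA : ∀ z, (A z).card ≤ (d + 1) * d := fun z =>
    (Finset.card_biUnion_le_card_mul _ _ d fun a _ => Finset.card_image_le.trans
      (by rw [card_neighborFinset_eq_degree, hG])).trans (Nat.mul_le_mul_right _ (hcl z))
  have hA' : ∀ z, (A' z).card ≤ (d + 1) * d := fun z =>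
    (Finset.card_biUnion_le_card_mul _ _ d fun a _ => Finset.card_image_le.trans
      (by rw [card_neighborFinset_eq_degree, hG])).trans (Nat.mul_le_mul_right _ (hcl z))
  have hQ : Q.card ≤ F.card * 2 := by
    refine Finset.card_biUnion_le_card_mul _ _ _ fun e _ => ?_
    induction e using Sym2.ind with
    | _ u v =>
      refine (Finset.card_le_card (t := {(u, v), (v, u)}) fun p hp => ?_).trans Finset.card_le_two
      simp only [Finset.mem_filter, Finset.mem_univ, true_and, Sym2.eq_iff] at hp
      simpa [Prod.ext_iff] using hp
  have hsub : D ⊆ P ∪ Q ∪ (A x ∪ A' y) := by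
    rintro ⟨a, b⟩ hab
    simp only [D, Finset.mem_filter, Finset.mem_univ, true_and] at hab
    by_contra hcon
    simp only [P, Q, A, A', Finset.mem_union, Finset.mem_filter, Finset.mem_univ, true_and,
      Finset.mem_biUnion, Finset.mem_insert, Finset.mem_image, mem_neighborFinset,
      not_or] at hcon
    obtain ⟨⟨h1, h2⟩, h3, h4⟩ := hcon
    refine h1 ⟨⟨hxy, hab, ?_, ?_, ?_, ?_⟩, fun h => h2 ⟨_, h, rfl⟩⟩
    · rintro rfl
      exact h3 ⟨_, Or.inl rfl, b, hab, rfl⟩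
    · rintro rfl
      exact h4 ⟨_, Or.inl rfl, a, hab.symm, rfl⟩
    · exact fun h => h3 ⟨a, Or.inr h, b, hab, rfl⟩
    · exact fun h => h4 ⟨b, Or.inr h, a, hab.symm, rfl⟩
  have h1 := Finset.card_le_card hsub
  have h2 := Finset.card_union_le (P ∪ Q) (A x ∪ A' y)
  have h3 := Finset.card_union_le P Q
  have h4 := Finset.card_union_le (A x) (A' y)
  have h5 := hA x
  have h6 := hA' y
  omega

-- Double counting of switchings that destroy the edge `e` and keep `F`. Each graph containing `e`
-- admits nearly `nd` of them, and each resulting graph arises from at most `d²`, so adding `e`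
-- costs a factor of about `d/n`.
open Classical in
theorem card_regularGraphs_insert_mul_le {d : ℕ} {F : Finset (Sym2 V)} {e : Sym2 V} (he : e ∉ F) :
    (regularGraphs V d (insert e F)).card *
      (Fintype.card V * d - (2 * F.card + 2 * ((d + 1) * d))) ≤
        (regularGraphs V d F).card * d ^ 2 := by
  induction e using Sym2.ind with
  | _ x y =>
  set S : SimpleGraph V → Finset (V × V) := fun G =>
    Finset.univ.filter fun p : V × V => G.Switchable x y p.1 p.2 ∧ s(p.1, p.2) ∉ F with hS
  have hX : ∀ G ∈ regularGraphs V d (insert s(x, y) F), (∀ v, G.degree v = d) ∧ G.Adj x y ∧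
      ∀ e ∈ F, e ∈ G.edgeSet := by
    intro G hG
    rw [mem_regularGraphs] at hG
    simp only [Finset.mem_insert, forall_eq_or_imp, mem_edgeSet] at hG
    exact ⟨hG.1, hG.2.1, hG.2.2⟩
  calc _ ≤ ∑ G ∈ regularGraphs V d (insert s(x, y) F), (S G).card := by
        rw [← smul_eq_mul, ← Finset.sum_const]
        refine Finset.sum_le_sum fun G hG => ?_
        have := card_le_card_switchable (hX G hG).1 (hX G hG).2.1 F
        simp only [hS]
        omega
    _ = ((regularGraphs V d (insert s(x, y) F)).sigma S).card := (Finset.card_sigma _ _).symm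
    -- After the switching `a` is a neighbour of `x` and `b` of `y`, which leaves `d²` choices for
    -- the pair.
    _ ≤ ((regularGraphs V d F).sigma fun G => G.neighborFinset x ×ˢ G.neighborFinset y).card := by
        refine Finset.card_le_card_of_injOn
          (fun g => ⟨g.1.switch x y g.2.1 g.2.2, g.2⟩) ?_ ?_
        · rintro ⟨G, a, b⟩ hg
          simp only [Finset.coe_sigma, Set.mem_sigma_iff, Finset.mem_coe, hS, Finset.mem_filter,
            Finset.mem_univ, true_and] at hg
          obtain ⟨hG, hsw, hab⟩ := hg
          obtain ⟨h1, h2, h3⟩ := hX G hG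
          simp only [Finset.coe_sigma, Set.mem_sigma_iff, Finset.mem_coe, mem_regularGraphs,
            Finset.mem_product, mem_neighborFinset]
          refine ⟨⟨fun v => (hsw.degree_switch v).trans (h1 v), fun e heF => ?_⟩,
            hsw.switch_adj_left, hsw.switch_adj_right⟩
          have heG := h3 e heF
          induction e using Sym2.ind with
          | _ p q =>
          rw [mem_edgeSet] at heG
          rw [mem_edgeSet, switch_adj]
          exact ⟨Or.inl ⟨heG, fun h => he (h ▸ heF), fun h => hab (h ▸ heF)⟩, heG.ne⟩
        · rintro ⟨G, a, b⟩ hg ⟨G', a', b'⟩ hg' hgg'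
          simp only [Finset.coe_sigma, Set.mem_sigma_iff, Finset.mem_coe, hS, Finset.mem_filter,
            Finset.mem_univ, true_and] at hg hg'
          simp only [Sigma.mk.injEq, heq_eq_eq, Prod.mk.injEq] at hgg'
          obtain ⟨h1, rfl, rfl⟩ := hgg'
          rw [hg.2.1.eq_of_switch_eq hg'.2.1 h1]
    _ = (regularGraphs V d F).card * d ^ 2 := by
        rw [Finset.card_sigma, ← smul_eq_mul, ← Finset.sum_const]
        refine Finset.sum_congr rfl fun G hG => ?_
        rw [mem_regularGraphs] at hG
        rw [Finset.card_product, card_neighborFinset_eq_degree, card_neighborFinset_eq_degree,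
          hG.1, hG.1, sq]

end Switching

end SimpleGraph

/-! ### Tail bound for codegrees -/

namespace SimpleGraph

section Codegree

variable {V : Type*} [Fintype V] {d : ℕ}

open Classical in
theorem card_regularGraphs_le {p : ℝ} {M : ℕ} (hp : 0 ≤ p)
    (hpos : 0 < (Fintype.card V * d : ℝ) - (2 * M + 2 * ((d + 1) * d)))
    (hpd : (d : ℝ) ^ 2 ≤ p * (Fintype.card V * d - (2 * M + 2 * ((d + 1) * d))))
    (F : Finset (Sym2 V)) (hF : F.card ≤ M) :
    ((regularGraphs V d F).card : ℝ) ≤ p ^ F.card * (regularGraphs V d ∅).card := by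
  induction F using Finset.induction_on with
  | empty => simp
  | insert e F he ih =>
    rw [Finset.card_insert_of_notMem he] at hF ⊢
    have ih := ih (by omega)
    set X : ℝ := ((regularGraphs V d (insert e F)).card : ℝ)
    set Y : ℝ := ((regularGraphs V d F).card : ℝ)
    have hY : 0 ≤ Y := Nat.cast_nonneg _
    set B : ℝ := Fintype.card V * d - (2 * M + 2 * ((d + 1) * d)) with hB
    have h1 : X * ((Fintype.card V * d - (2 * F.card + 2 * ((d + 1) * d)) : ℕ) : ℝ) ≤
        Y * d ^ 2 := by
      simp only [X, Y]
      exact_mod_cast card_regularGraphs_insert_mul_le (V := V) (d := d) he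
    have h2 : B ≤ ((Fintype.card V * d - (2 * F.card + 2 * ((d + 1) * d)) : ℕ) : ℝ) := by
      rw [hB, sub_le_iff_le_add]
      have h3 : Fintype.card V * d ≤ (Fintype.card V * d - (2 * F.card + 2 * ((d + 1) * d))) +
          (2 * M + 2 * ((d + 1) * d)) := by omega
      exact_mod_cast h3
    have h4 : X * B ≤ (Y * p) * B := by
      calc X * B ≤ _ := mul_le_mul_of_nonneg_left h2 (Nat.cast_nonneg _)
        _ ≤ Y * d ^ 2 := h1
        _ ≤ Y * (p * B) := mul_le_mul_of_nonneg_left hpd hY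
        _ = (Y * p) * B := by ring
    calc X ≤ Y * p := le_of_mul_le_mul_right h4 hpos
      _ ≤ (p ^ F.card * (regularGraphs V d ∅).card) * p := mul_le_mul_of_nonneg_right ih hp
      _ = _ := by ring

-- Having `T` in the common neighbourhood prescribes `2t` distinct edges, unless `T` meets `{u, v}`,
-- when it is impossible.
open Classical in
theorem card_powersetCard_subset_common_le {p : ℝ} {t : ℕ} (hp : 0 ≤ p)
    (hpos : 0 < (Fintype.card V * d : ℝ) - (2 * (2 * t : ℕ) + 2 * ((d + 1) * d)))
    (hpd : (d : ℝ) ^ 2 ≤ p * (Fintype.card V * d - (2 * (2 * t : ℕ) + 2 * ((d + 1) * d))))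
    {u v : V} (huv : u ≠ v) {T : Finset V} (hT : T.card = t) :
    (((regularGraphs V d ∅).filter fun G =>
      T ⊆ G.neighborFinset u ∩ G.neighborFinset v).card : ℝ) ≤
        p ^ (2 * t) * (regularGraphs V d ∅).card := by
  by_cases hmem : u ∈ T ∨ v ∈ T
  · rw [Finset.filter_eq_empty_iff.2]
    · simp only [Finset.card_empty, Nat.cast_zero]
      positivity
    · intro G _ h
      rcases hmem with hu | hv
      · simpa using h hu
      · simpa using h hv
  · rw [not_or] at hmem
    set F := T.image (fun w => s(u, w)) ∪ T.image (fun w => s(v, w)) with hF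
    have hinj : ∀ z : V, Function.Injective fun w => s(z, w) := fun z w w' h =>
      Sym2.congr_right.1 h
    have hcard : F.card = 2 * t := by
      rw [hF, Finset.card_union_of_disjoint, Finset.card_image_of_injective _ (hinj u),
        Finset.card_image_of_injective _ (hinj v), hT]
      · omega
      · rw [Finset.disjoint_left]
        simp only [Finset.mem_image, not_exists, not_and]
        rintro _ ⟨w, hw, rfl⟩ w' hw' h
        rw [Sym2.eq_iff] at h
        rcases h with ⟨h, -⟩ | ⟨-, h⟩
        · exact huv h.symm
        · exact hmem.1 (h ▸ hw')
    rw [← hcard]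
    refine le_trans ?_ (card_regularGraphs_le hp hpos hpd F hcard.le)
    refine Nat.cast_le.2 (Finset.card_le_card fun G hG => ?_)
    rw [Finset.mem_filter, mem_regularGraphs] at hG
    rw [mem_regularGraphs]
    refine ⟨hG.1.1, fun e he => ?_⟩
    simp only [hF, Finset.mem_union, Finset.mem_image] at he
    rcases he with ⟨w, hw, rfl⟩ | ⟨w, hw, rfl⟩
    · simpa using (Finset.mem_inter.1 (hG.2 hw)).1
    · simpa using (Finset.mem_inter.1 (hG.2 hw)).2

-- Markov's inequality for the binomial moment: a graph with codegree at least `m` has at least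
-- `m.choose t` common `t`-sets.
open Classical in
theorem card_le_codegree_mul_choose_le {p : ℝ} {t : ℕ} (hp : 0 ≤ p)
    (hpos : 0 < (Fintype.card V * d : ℝ) - (2 * (2 * t : ℕ) + 2 * ((d + 1) * d)))
    (hpd : (d : ℝ) ^ 2 ≤ p * (Fintype.card V * d - (2 * (2 * t : ℕ) + 2 * ((d + 1) * d))))
    {u v : V} (huv : u ≠ v) (m : ℕ) :
    (((regularGraphs V d ∅).filter fun G =>
      m ≤ (G.neighborFinset u ∩ G.neighborFinset v).card).card : ℝ) * m.choose t ≤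
        (Fintype.card V).choose t * (p ^ (2 * t) * (regularGraphs V d ∅).card) := by
  set R := regularGraphs V d ∅
  set P := Finset.powersetCard t (Finset.univ : Finset V)
  set r : SimpleGraph V → Finset V → Prop := fun G T => T ⊆ G.neighborFinset u ∩ G.neighborFinset v
  set Q := R.filter fun G => m ≤ (G.neighborFinset u ∩ G.neighborFinset v).card
  have h1 : Q.card * m.choose t ≤ ∑ G ∈ R, (P.bipartiteAbove r G).card := by
    calc Q.card * m.choose t = ∑ G ∈ Q, m.choose t := by rw [Finset.sum_const, smul_eq_mul]
      _ ≤ ∑ G ∈ Q, (P.bipartiteAbove r G).card := by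
          refine Finset.sum_le_sum fun G hG => ?_
          refine (Nat.choose_le_choose t (Finset.mem_filter.1 hG).2).trans ?_
          rw [← Finset.card_powersetCard]
          refine Finset.card_le_card fun T hT => ?_
          rw [Finset.mem_powersetCard] at hT
          simp only [Finset.bipartiteAbove, Finset.mem_filter, P, Finset.mem_powersetCard]
          exact ⟨⟨Finset.subset_univ _, hT.2⟩, hT.1⟩
      _ ≤ _ := Finset.sum_le_sum_of_subset (Finset.filter_subset _ _)
  rw [Finset.sum_card_bipartiteAbove_eq_sum_card_bipartiteBelow] at h1
  calc (Q.card : ℝ) * m.choose t ≤ ∑ T ∈ P, ((R.bipartiteBelow r T).card : ℝ) := by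
        exact_mod_cast h1
    _ ≤ ∑ T ∈ P, p ^ (2 * t) * R.card := Finset.sum_le_sum fun T hT =>
        card_powersetCard_subset_common_le hp hpos hpd huv (Finset.mem_powersetCard.1 hT).2
    _ = _ := by
        rw [Finset.sum_const, Finset.card_powersetCard, Finset.card_univ, nsmul_eq_mul]

open Classical in
theorem card_large_codegree_le (h1 : 1000 * d ≤ Fintype.card V)
    (h2 : 1000 * Fintype.card V ≤ d ^ 2) (hd : 0 < d) {u v : V} (huv : u ≠ v) :
    (((regularGraphs V d ∅).filter fun G => 3 / 2 * ((d : ℝ) ^ 2 / Fintype.card V) <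
      (G.neighborFinset u ∩ G.neighborFinset v).card).card : ℝ) ≤
        (9 / 10) ^ ⌊(d : ℝ) ^ 2 / Fintype.card V / 10⌋₊ * (regularGraphs V d ∅).card := by
  have hd0 : (0 : ℝ) < d := by exact_mod_cast hd
  have h1' : 1000 * (d : ℝ) ≤ Fintype.card V := by exact_mod_cast h1
  have h2' : 1000 * (Fintype.card V : ℝ) ≤ (d : ℝ) ^ 2 := by exact_mod_cast h2
  set n : ℝ := (Fintype.card V : ℝ)
  have hn : 0 < n := by linarith
  set q : ℝ := (d : ℝ) ^ 2 / n with hq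
  have hqn : q * n = (d : ℝ) ^ 2 := div_mul_cancel₀ _ hn.ne'
  have hq0 : 0 < q := by positivity
  have hqd : 1000 * q ≤ d := by
    rw [hq, mul_div_assoc', div_le_iff₀ hn]
    nlinarith
  -- The order `t` is small enough that `m + 1 - t ≥ (7/5) q`. The moment ratio per step is then at
  -- most `1.21 / 1.4 < 9/10`, where `n p² = 1.21 q`.
  set t := ⌊q / 10⌋₊
  have ht : (t : ℝ) ≤ q / 10 := Nat.floor_le (by positivity)
  -- The factor `11/10` absorbs the lower-order loss `5 d²` in the number of switchings.
  set p : ℝ := 11 / 10 * (d / n) with hp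
  have hp0 : 0 ≤ p := by positivity
  have hpn : p * n = 11 / 10 * d := by rw [hp]; field_simp
  have hp1 : p ≤ 11 / 10000 := by
    have : (d : ℝ) / n ≤ 1 / 1000 := by rw [div_le_div_iff₀ hn (by norm_num)]; linarith
    linarith
  have hd1 : (1 : ℝ) ≤ d := by exact_mod_cast hd
  have hsmall : 2 * ((2 * t : ℕ) : ℝ) + 2 * ((d + 1) * d) ≤ 5 * (d : ℝ) ^ 2 := by
    push_cast
    nlinarith
  have hnd : n * d - (2 * ((2 * t : ℕ) : ℝ) + 2 * ((d + 1) * d)) ≥ n * d - 5 * (d : ℝ) ^ 2 := by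
    linarith
  have hpos : 0 < n * d - (2 * ((2 * t : ℕ) : ℝ) + 2 * ((d + 1) * d)) := by
    nlinarith
  have hpd : (d : ℝ) ^ 2 ≤ p * (n * d - (2 * ((2 * t : ℕ) : ℝ) + 2 * ((d + 1) * d))) := by
    calc (d : ℝ) ^ 2 ≤ 11 / 10 * d * d - p * (5 * (d : ℝ) ^ 2) := by
          nlinarith [mul_le_mul_of_nonneg_right hp1 (sq_nonneg (d : ℝ))]
      _ = p * (n * d - 5 * (d : ℝ) ^ 2) := by rw [← hpn]; ring
      _ ≤ _ := mul_le_mul_of_nonneg_left hnd hp0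
  set m := ⌊3 / 2 * q⌋₊ + 1 with hm
  have hmq : 3 / 2 * q < m := by rw [hm]; push_cast; exact Nat.lt_floor_add_one _
  set R := regularGraphs V d ∅
  have hsub : (R.filter fun G => 3 / 2 * q < (G.neighborFinset u ∩ G.neighborFinset v).card) ⊆
      R.filter fun G => m ≤ (G.neighborFinset u ∩ G.neighborFinset v).card := by
    intro G hG
    rw [Finset.mem_filter] at hG ⊢
    exact ⟨hG.1, Nat.succ_le_of_lt ((Nat.floor_lt (by positivity)).2 hG.2)⟩
  refine (Nat.cast_le.2 (Finset.card_le_card hsub)).trans ?_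
  have key := card_le_codegree_mul_choose_le hp0 hpos hpd huv m
  set X : ℝ := ((R.filter fun G =>
    m ≤ (G.neighborFinset u ∩ G.neighborFinset v).card).card : ℝ)
  have hX : 0 ≤ X := Nat.cast_nonneg _
  have htm : t ≤ m := by
    have : (t : ℝ) ≤ m := by linarith
    exact_mod_cast this
  set a : ℝ := ((m + 1 - t : ℕ) : ℝ) with ha
  have haq : 7 / 5 * q ≤ a := by
    rw [ha, Nat.cast_sub (by omega)]
    push_cast
    linarith
  have ha0 : 0 < a := by linarith
  have hlow : a ^ t / t.factorial ≤ m.choose t := by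
    exact Nat.pow_le_choose t m
  have hup : ((Fintype.card V).choose t : ℝ) ≤ n ^ t / t.factorial :=
    Nat.choose_le_pow_div t _
  have hfac : (0 : ℝ) < t.factorial := by exact_mod_cast t.factorial_pos
  have hRc : (0 : ℝ) ≤ p ^ (2 * t) * R.card := by positivity
  have h3 : X * (a ^ t / t.factorial) ≤ n ^ t / t.factorial * (p ^ (2 * t) * R.card) :=
    (mul_le_mul_of_nonneg_left hlow hX).trans (key.trans (mul_le_mul_of_nonneg_right hup hRc))
  have h4 : X * a ^ t ≤ (n * p ^ 2) ^ t * R.card := by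
    rw [mul_div_assoc', div_mul_eq_mul_div, div_le_div_iff_of_pos_right hfac] at h3
    refine h3.trans (le_of_eq ?_)
    rw [mul_pow n, ← pow_mul p]
    ring
  have h5 : n * p ^ 2 ≤ 9 / 10 * a := by
    have : n * p ^ 2 = 121 / 100 * q := by
      rw [hp, hq]
      field_simp
      norm_num
    linarith
  have h6 : (n * p ^ 2) ^ t ≤ (9 / 10) ^ t * a ^ t := by
    rw [← mul_pow]
    exact pow_le_pow_left₀ (by positivity) h5 t
  have h7 : X * a ^ t ≤ ((9 / 10) ^ t * R.card) * a ^ t := by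
    calc X * a ^ t ≤ (n * p ^ 2) ^ t * R.card := h4
      _ ≤ ((9 / 10) ^ t * a ^ t) * R.card := mul_le_mul_of_nonneg_right h6 (Nat.cast_nonneg _)
      _ = _ := by ring
  exact le_of_mul_le_mul_right h7 (by positivity)

open Classical in
theorem card_exists_large_codegree_le (h1 : 1000 * d ≤ Fintype.card V)
    (h2 : 1000 * Fintype.card V ≤ d ^ 2) (hd : 0 < d) :
    (((regularGraphs V d ∅).filter fun G => ∃ u v, u ≠ v ∧
      3 / 2 * ((d : ℝ) ^ 2 / Fintype.card V) <
        (G.neighborFinset u ∩ G.neighborFinset v).card).card : ℝ) ≤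
      (Fintype.card V : ℝ) ^ 2 * (9 / 10) ^ ⌊(d : ℝ) ^ 2 / Fintype.card V / 10⌋₊ *
        (regularGraphs V d ∅).card := by
  set R := regularGraphs V d ∅
  set B : V × V → Finset (SimpleGraph V) := fun z =>
    R.filter fun G => z.1 ≠ z.2 ∧ 3 / 2 * ((d : ℝ) ^ 2 / Fintype.card V) <
      (G.neighborFinset z.1 ∩ G.neighborFinset z.2).card
  have hsub : (R.filter fun G => ∃ u v, u ≠ v ∧ 3 / 2 * ((d : ℝ) ^ 2 / Fintype.card V) <
      (G.neighborFinset u ∩ G.neighborFinset v).card) ⊆ Finset.univ.biUnion B := by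
    intro G hG
    rw [Finset.mem_filter] at hG
    obtain ⟨hGR, u, v, h⟩ := hG
    rw [Finset.mem_biUnion]
    exact ⟨(u, v), Finset.mem_univ _, Finset.mem_filter.2 ⟨hGR, h⟩⟩
  calc _ ≤ ((Finset.univ.biUnion B).card : ℝ) := Nat.cast_le.2 (Finset.card_le_card hsub)
    _ ≤ ∑ z : V × V, ((B z).card : ℝ) := by exact_mod_cast Finset.card_biUnion_le
    _ ≤ ∑ _z : V × V, ((9 / 10) ^ ⌊(d : ℝ) ^ 2 / Fintype.card V / 10⌋₊ * (R.card : ℝ)) := by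
        refine Finset.sum_le_sum fun z _ => ?_
        by_cases hz : z.1 = z.2
        · have : B z = ∅ := Finset.filter_eq_empty_iff.2 fun G _ h => h.1 hz
          rw [this]
          simp only [Finset.card_empty, Nat.cast_zero]
          positivity
        · refine le_trans (Nat.cast_le.2 (Finset.card_le_card fun G hG => ?_))
            (card_large_codegree_le h1 h2 hd hz)
          rw [Finset.mem_filter] at hG ⊢
          exact ⟨hG.1, hG.2.2⟩
    _ = _ := by
        rw [Finset.sum_const, Finset.card_univ, Fintype.card_prod, nsmul_eq_mul]
        push_cast
        ring

end Codegree

end SimpleGraph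

/-! ### From counting to probability -/

instance simpleGraph_measurableSingletonClass {V : Type*} [Countable V] :
    MeasurableSingletonClass (SimpleGraph V) := by
  refine ⟨fun G => ⟨{G.Adj}, measurableSet_singleton _, ?_⟩⟩
  ext H
  simp [SimpleGraph.adj_inj]

open Classical in
theorem one_sub_le_randomRegularGraph_real {n d : ℕ} (h1 : 1000 * d ≤ n) (h2 : 1000 * n ≤ d ^ 2)
    (hd : 0 < d) (heven : Even (n * d)) {A : Set (SimpleGraph (Fin n))}
    (hA : ∀ G : SimpleGraph (Fin n), (∀ v, G.degree v = d) →
      (∀ u v, u ≠ v → ((G.neighborFinset u ∩ G.neighborFinset v).card : ℝ) ≤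
        3 / 2 * ((d : ℝ) ^ 2 / n)) → G ∈ A) :
    1 - (n : ℝ) ^ 2 * (9 / 10) ^ ⌊(d : ℝ) ^ 2 / n / 10⌋₊ ≤ (randomRegularGraph n d).real A := by
  set R := SimpleGraph.regularGraphs (Fin n) d ∅ with hR
  have hset : {G : SimpleGraph (Fin n) | G.IsRegularOfDegree d} = (R : Set _) := by
    ext G
    simp only [hR, SimpleGraph.mem_regularGraphs, Finset.mem_coe, Set.mem_ofPred_eq,
      SimpleGraph.IsRegularOfDegree, Finset.notMem_empty, false_imp_iff, implies_true, and_true]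
  -- Parity of `n d` enters here, through the existence of a `d`-regular graph.
  have hRpos : (0 : ℝ) < R.card := by
    obtain ⟨G, hG⟩ := exists_isRegularOfDegree (by omega : d < n) heven
    have : G ∈ (R : Set _) := hset ▸ hG
    exact_mod_cast Finset.card_pos.2 ⟨G, this⟩
  have hAfin : A = ((Finset.univ.filter (· ∈ A) : Finset (SimpleGraph (Fin n))) : Set _) := by
    simp
  have hbad := SimpleGraph.card_exists_large_codegree_le (V := Fin n) (d := d)
    (by simpa using h1) (by simpa using h2) hd
  simp only [Fintype.card_fin] at hbad
  rw [← hR] at hbad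
  set B := R.filter fun G => ∃ u v, u ≠ v ∧ 3 / 2 * ((d : ℝ) ^ 2 / n) <
    (G.neighborFinset u ∩ G.neighborFinset v).card
  have hcard : R.card ≤ (R ∩ Finset.univ.filter (· ∈ A)).card + B.card := by
    refine (Finset.card_le_card fun G hG => ?_).trans (Finset.card_union_le _ _)
    simp only [Finset.mem_union, Finset.mem_inter, Finset.mem_filter, Finset.mem_univ, true_and, B]
    by_cases hB : ∃ u v, u ≠ v ∧ 3 / 2 * ((d : ℝ) ^ 2 / n) <
        (G.neighborFinset u ∩ G.neighborFinset v).card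
    · exact Or.inr ⟨hG, hB⟩
    · push Not at hB
      exact Or.inl ⟨hG, hA G (SimpleGraph.mem_regularGraphs.1 hG).1 hB⟩
  have hcard' : (R.card : ℝ) ≤ (R ∩ Finset.univ.filter (· ∈ A)).card + B.card := by
    exact_mod_cast hcard
  have hreal : (randomRegularGraph n d).real A =
      ((R ∩ Finset.univ.filter (· ∈ A)).card : ℝ) / R.card := by
    rw [randomRegularGraph, hset, measureReal_def]
    conv_lhs => rw [hAfin]
    rw [uniformOn_apply_finset, ENNReal.toReal_div, ENNReal.toReal_natCast, ENNReal.toReal_natCast]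
  have hbad' : (B.card : ℝ) ≤
      (n : ℝ) ^ 2 * (9 / 10) ^ ⌊(d : ℝ) ^ 2 / n / 10⌋₊ * R.card := by
    convert hbad
  rw [hreal, le_div_iff₀ hRpos, sub_mul, one_mul]
  linarith

/-- The law is zero when no `d`-regular graph exists; in either case probabilities are at most `1`.
-/
instance randomRegularGraph_isZeroOrProbabilityMeasure (n d : ℕ) :
    IsZeroOrProbabilityMeasure (randomRegularGraph n d) := by
  unfold randomRegularGraph
  infer_instance

/-! ### Asymptotics -/

theorem natCast_rpow_isLittleO {p q : ℝ} (h : p < q) :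
    (fun n : ℕ => (n : ℝ) ^ p) =o[atTop] fun n : ℕ => (n : ℝ) ^ q := by
  have hpos : ∀ᶠ n : ℕ in atTop, (0 : ℝ) < n :=
    (eventually_gt_atTop 0).mono fun n hn => by exact_mod_cast hn
  refine isLittleO_of_tendsto' (hpos.mono fun n hn h0 => absurd h0 (Real.rpow_pos_of_pos hn q).ne')
    ?_
  refine Tendsto.congr' (hpos.mono fun n hn => ?_)
    ((tendsto_rpow_neg_atTop (sub_pos.2 h)).comp tendsto_natCast_atTop_atTop)
  rw [Function.comp_apply, neg_sub, Real.rpow_sub hn]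

/-- In terms of `x = n^β` the bound is `x^(2/β)` times an exponentially small factor in `x`;
rounding down costs at most the constant `exp b`. -/
theorem tendsto_sq_mul_pow_floor {u : ℕ → ℝ} {β : ℝ} (hβ : 0 < β)
    (hu : (fun n : ℕ => (n : ℝ) ^ β) =O[atTop] u) (hu0 : ∀ᶠ n in atTop, 0 ≤ u n) :
    Tendsto (fun n : ℕ => (n : ℝ) ^ 2 * (9 / 10 : ℝ) ^ ⌊u n⌋₊) atTop (𝓝 0) := by
  obtain ⟨C, hC, hCu⟩ := hu.exists_pos
  set b : ℝ := -Real.log (9 / 10) with hb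
  have hb0 : 0 < b := by
    rw [hb, neg_pos]
    exact Real.log_neg (by norm_num) (by norm_num)
  have hlim : Tendsto (fun n : ℕ => Real.exp b *
      (((n : ℝ) ^ β) ^ (2 / β) * Real.exp (-(b / C) * (n : ℝ) ^ β))) atTop (𝓝 0) := by
    have := ((tendsto_rpow_mul_exp_neg_mul_atTop_nhds_zero (2 / β) (b / C) (by positivity)).comp
      ((tendsto_rpow_atTop hβ).comp tendsto_natCast_atTop_atTop)).const_mul (Real.exp b)
    simpa using this
  refine squeeze_zero' (Eventually.of_forall fun n => by positivity) ?_ hlim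
  filter_upwards [hCu.bound, hu0] with n hn hun
  have hn0 : (0 : ℝ) ≤ (n : ℝ) ^ β := by positivity
  rw [Real.norm_of_nonneg hn0, Real.norm_of_nonneg hun] at hn
  have h1 : ((n : ℝ) ^ β) ^ (2 / β) = (n : ℝ) ^ 2 := by
    rw [← Real.rpow_mul (Nat.cast_nonneg n), mul_div_cancel₀ _ hβ.ne']
    norm_num
  have h2 : (9 / 10 : ℝ) ^ ⌊u n⌋₊ = Real.exp (-b * ⌊u n⌋₊) := by
    rw [hb, neg_neg, mul_comm, Real.exp_nat_mul, Real.exp_log (by norm_num)]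
  have h3 : (n : ℝ) ^ β / C - 1 ≤ ⌊u n⌋₊ := by
    have := Nat.lt_floor_add_one (u n)
    have : (n : ℝ) ^ β / C ≤ u n := by rwa [div_le_iff₀' hC]
    linarith
  rw [h1, h2, mul_left_comm, ← Real.exp_add]
  refine mul_le_mul_of_nonneg_left (Real.exp_le_exp.2 ?_) (by positivity)
  have := mul_le_mul_of_nonneg_left h3 hb0.le
  calc -b * (⌊u n⌋₊ : ℝ) ≤ -(b * ((n : ℝ) ^ β / C - 1)) := by linarith
    _ = _ := by ring

theorem one_sub_le_real_sparsifiedGrid {n d L s : ℕ} (h1 : 1000 * d ≤ n) (h2 : 1000 * n ≤ d ^ 2)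
    (hd : 0 < d) (heven : Even (n * d)) (hsd : 1000 * s ≤ d) (hsn : 1000 * (s * d) ≤ n)
    (hs : 33 ≤ s) (hLs : Nat.card (SparsifiedGridVertex L) ≤ s) :
    1 - (n : ℝ) ^ 2 * (9 / 10) ^ ⌊(d : ℝ) ^ 2 / n / 10⌋₊ ≤
      (randomRegularGraph n d).real {G | (sparsifiedGrid L).IsIndContained G} := by
  classical
  refine one_sub_le_randomRegularGraph_real h1 h2 hd heven fun G hreg hK => ?_
  have hn : 0 < n := by omega
  have : Nonempty (Fin n) := ⟨⟨0, hn⟩⟩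
  have hn0 : (0 : ℝ) < n := by exact_mod_cast hn
  have hd0 : (0 : ℝ) < d := by exact_mod_cast hd
  have h1' : 1000 * (d : ℝ) ≤ n := by exact_mod_cast h1
  have h2' : 1000 * (n : ℝ) ≤ (d : ℝ) ^ 2 := by exact_mod_cast h2
  have hsd' : 1000 * (s : ℝ) ≤ d := by exact_mod_cast hsd
  have hsn' : 1000 * ((s : ℝ) * d) ≤ n := by exact_mod_cast hsn
  have hK1 : 100 * (3 / 2 * ((d : ℝ) ^ 2 / n)) ≤ d := by
    rw [mul_div_assoc', mul_div_assoc', div_le_iff₀ hn0]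
    nlinarith
  -- Since `K` is of order `d²/n`, the requirement that `s K` be small against `d` amounts to `s d`
  -- being small against `n`.
  have hK2 : (s : ℝ) * (3 / 2 * ((d : ℝ) ^ 2 / n)) ≤ d / 100 := by
    rw [mul_div_assoc', mul_div_assoc', div_le_div_iff₀ hn0 (by norm_num)]
    nlinarith
  refine sparsifiedGrid_isIndContained (K := 3 / 2 * ((d : ℝ) ^ 2 / n)) (s := s) (d := d)
    (fun v => by convert hreg v) hd (fun u v huv => by convert hK u v huv) (by positivity) hK1
    ?_ ?_ ?_ ?_ L hLs hs
  · rw [Fintype.card_fin]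
    refine le_of_eq ?_
    field_simp
  · rw [Fintype.card_fin]
    linarith
  · linarith
  · rw [Fintype.card_fin, mul_add, mul_one]
    omega

theorem mainTheorem4 (c : ℝ) (hc : 1 / 2 < c) (hc' : c < 1)
    (d L : ℕ → ℕ)
    (hd : (fun n : ℕ => (d n : ℝ)) =Θ[atTop] fun n : ℕ => (n : ℝ) ^ c)
    (hv : (fun n : ℕ => (Nat.card (SparsifiedGridVertex (L n)) : ℝ)) =o[atTop]
      fun n : ℕ => (n : ℝ) ^ min ((1 - c) / 2) (c / 3)) :
    Tendsto
      (fun n : ℕ => (randomRegularGraph n (d n)).real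
        {G | (sparsifiedGrid (L n)).IsIndContained G})
      (atTop ⊓ 𝓟 {n : ℕ | Even (n * d n)}) (𝓝 1) := by
  -- The padding by `33` makes room for the lattice sets used for `L = 2, 3`; it is negligible
  -- because `k > 0`.
  set s : ℕ → ℕ := fun n => Nat.card (SparsifiedGridVertex (L n)) + 33 with hs
  set k : ℝ := min ((1 - c) / 2) (c / 3)
  have hk0 : 0 < k := lt_min (by linarith) (by linarith)
  have hk1 : k ≤ (1 - c) / 2 := min_le_left _ _
  have hk2 : k ≤ c / 3 := min_le_right _ _
  have hconst : (fun _ : ℕ => (33 : ℝ)) =o[atTop] fun n : ℕ => (n : ℝ) ^ k := by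
    rw [isLittleO_const_left]
    refine Or.inr (tendsto_norm_atTop_atTop.comp
      ((tendsto_rpow_atTop hk0).comp tendsto_natCast_atTop_atTop))
  have hsk : (fun n => (s n : ℝ)) =o[atTop] fun n : ℕ => (n : ℝ) ^ k := by
    refine (hv.add hconst).congr_left fun n => ?_
    simp [hs]
  have hpos : ∀ᶠ n : ℕ in atTop, (0 : ℝ) < n :=
    (eventually_gt_atTop 0).mono fun n hn => by exact_mod_cast hn
  have hrpow1 : (fun n : ℕ => (n : ℝ) ^ (1 : ℝ)) = fun n : ℕ => (n : ℝ) := by simp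
  have hdn : (fun n => (d n : ℝ)) =o[atTop] fun n : ℕ => (n : ℝ) := by
    rw [← hrpow1]
    exact hd.1.trans_isLittleO (natCast_rpow_isLittleO hc')
  have hd2 : (fun n : ℕ => (n : ℝ) ^ (2 * c)) =O[atTop] fun n => (d n : ℝ) ^ 2 := by
    refine (hd.2.pow 2).congr_left fun n => ?_
    rw [mul_comm, Real.rpow_mul (Nat.cast_nonneg n)]
    norm_num
  have hnd : (fun n : ℕ => (n : ℝ)) =o[atTop] fun n => (d n : ℝ) ^ 2 := by
    rw [← hrpow1]
    exact (natCast_rpow_isLittleO (by linarith)).trans_isBigO hd2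
  have hsd : (fun n => (s n : ℝ)) =o[atTop] fun n => (d n : ℝ) :=
    (hsk.trans (natCast_rpow_isLittleO (by linarith))).trans_isBigO hd.2
  -- Here `k + c ≤ (1 + c)/2 < 1`.
  have hsdn : (fun n => (s n : ℝ) * d n) =o[atTop] fun n : ℕ => (n : ℝ) := by
    refine ((hsk.mul_isBigO hd.1).congr' EventuallyEq.rfl
      (hpos.mono fun n hn => (Real.rpow_add hn k c).symm)).trans ?_
    rw [← hrpow1]
    exact natCast_rpow_isLittleO (by linarith)
  -- The exponent `2c - 1` is positive because `c > 1/2`, so the codegree tail beats the union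
  -- bound.
  have hu : (fun n : ℕ => (n : ℝ) ^ (2 * c - 1)) =O[atTop]
      fun n => (d n : ℝ) ^ 2 / n / 10 := by
    have h1 : (fun n : ℕ => (n : ℝ) ^ (2 * c) * (n : ℝ)⁻¹) =O[atTop]
        fun n => (d n : ℝ) ^ 2 * (n : ℝ)⁻¹ := hd2.mul (isBigO_refl _ _)
    refine (h1.congr' (hpos.mono fun n hn => ?_) EventuallyEq.rfl).trans
      ((isBigO_const_mul_self (10 : ℝ) (fun n => (d n : ℝ) ^ 2 / n / 10) atTop).congr_left
        fun n => ?_)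
    · simp only [Real.rpow_sub hn, Real.rpow_one, div_eq_mul_inv]
    · ring
  have hlim := tendsto_sq_mul_pow_floor (by linarith) hu
    (Eventually.of_forall fun n => by positivity)
  have hlim1 := (hlim.const_sub 1).mono_left
    (inf_le_left : atTop ⊓ 𝓟 {n : ℕ | Even (n * d n)} ≤ atTop)
  rw [sub_zero] at hlim1
  refine tendsto_of_tendsto_of_tendsto_of_le_of_le' hlim1 tendsto_const_nhds ?_
    (Eventually.of_forall fun n => measureReal_le_one)
  rw [eventually_inf_principal]
  have hc0 : (0 : ℝ) < 1 / 1000 := by norm_num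
  filter_upwards [hdn.bound hc0, hnd.bound hc0, hsd.bound hc0, hsdn.bound hc0, hpos] with
    n e1 e2 e3 e4 hn heven
  simp only [norm_mul, norm_pow, RCLike.norm_natCast] at e1 e2 e3 e4
  have e2' : 1000 * (n : ℝ) ≤ (d n : ℝ) ^ 2 := by linarith
  have hd0 : 0 < d n := by
    rcases Nat.eq_zero_or_pos (d n) with h0 | h0
    · rw [h0] at e2'
      norm_num at e2'
      linarith
    · exact h0
  have e1' : 1000 * (d n : ℝ) ≤ n := by linarith
  have e3' : 1000 * (s n : ℝ) ≤ d n := by linarith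
  have e4' : 1000 * ((s n : ℝ) * d n) ≤ n := by linarith
  exact one_sub_le_real_sparsifiedGrid (by exact_mod_cast e1') (by exact_mod_cast e2') hd0 heven
    (s := s n) (by exact_mod_cast e3') (by exact_mod_cast e4') (Nat.le_add_left _ _)
    (Nat.le_add_right _ _)
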